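/- Let $\mathbb Z_+=\{1,2,\dots\}$ and let $a(n)$ $(n\ge 0)$ and $b(n)$ $(n\ge 1)$ be real numbers with $a(n)\neq 0$ for all $n$, $a(0)=1$ and $\sum_{n\ge 1}|a(n)|^{-1}=\infty$. Let $H_+$ be the self-adjoint operator on $\ell^2(\mathbb Z_+)$ given by $$(H_+u)(n)=a(n)u(n+1)+a(n-1)u(n-1)+b(n)u(n),\qquad n\ge 1,\quad u(0)=0,$$ with domain all $u\in\ell^2(\mathbb Z_+)$ for which the right-hand side is in $\ell^2(\mathbb Z_+)$. Let $\mu^+$ be its spectral measure at $\delta_1$, i.e. the finite Borel measure on $\mathbb R$ with $\langle (H_+-z)^{-1}\delta_1,\delta_1\rangle=\int_{\mathbb R}\frac{d\mu^+(x)}{x-z}$ for all $z\in\mathbb C\setminus\mathbb R$. For $\varphi:\mathbb Z_+\to\mathbb C$ and $L\ge 0$ put $$\|\varphi\|_L^2=\sum_{n=1}^{\lfloor L\rfloor}|\varphi(n)|^2+(L-\lfloor L\rfloor)|\varphi(\lfloor L\rfloor+1)|^2,$$ and for $T>0$ put $\langle A(t)\rangle_T=\frac2T\int_0^\infty e^{-2t/T}A(t)\,dt$.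 For $E\in\mathbb R$ let $u_\theta(n,E)$, $n\ge 0$, be the solution of $a(n)u(n+1)+a(n-1)u(n-1)+b(n)u(n)=Eu(n)$ $(n\ge1)$ with $u_\theta(0,E)=\sin\theta$, $u_\theta(1,E)=\cos\theta$. Let $$\Phi(n,E)=\begin{pmatrix}u_0(n+1,E)&u_{\pi/2}(n+1,E)\\u_0(n,E)&u_{\pi/2}(n,E)\end{pmatrix},$$ let $\|\Phi(n,E)\|$ be its operator norm, and for $L\ge 1$ let $$\|\Phi(E)\|_L^2=\sum_{n=1}^{\lfloor L\rfloor-1}\|\Phi(n,E)\|^2+(L-\lfloor L\rfloor)\|\Phi(\lfloor L\rfloor,E)\|^2 .$$ For $\epsilon>0$ let $\tilde L^+_\epsilon(E)$ be the unique $L\ge 1$ with $\|\Phi(E)\|_L=2\|\Phi(1,E)^{-1}\|\,\epsilon^{-1}$. Then there is a universal constant $C>0$ (independent of $a$, $b$, $T$ and $L$) such that for all $T>0$ and $L\ge 2$, $$\big\langle\|e^{-iH_+t}\delta_1\|_L^2\big\rangle_T> C\,\mu^+\big(\{E\in\mathbb R:\ \tilde L^+_{T^{-1}}(E)\le L\}\big).$$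 -/

import Mathlib

noncomputable section

namespace JacobiDyn

open MeasureTheory

/-! ## Unbounded self-adjoint operators on a Hilbert space -/

section Abstract

variable {E : Type*} [NormedAddCommGroup E] [InnerProductSpace ℂ E] [CompleteSpace E]

/-- `U` is the strongly continuous one-parameter unitary group generated by `-iA`, that is,
`U t = e^{-itA}`: it is a unitary group, strongly continuous, and the pairs `(x, y)` with
`y = A x` are exactly those for which `t ↦ U t x` is differentiable at `0` with derivative `-i y`.
By Stone's theorem there is exactly one such `U` when `A` is self-adjoint. -/
structure IsUnitaryGroupOf (A : E →ₗ.[ℂ] E) (U : ℝ → E →L[ℂ] E) : Prop where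
  unitary : ∀ t, U t ∈ unitary (E →L[ℂ] E)
  zero : U 0 = 1
  add : ∀ s t, U (s + t) = U s * U t
  continuous : ∀ x, Continuous fun t => U t x
  generator : ∀ x y : E,
    (x, y) ∈ A.graph ↔ HasDerivAt (fun t : ℝ => U t x) (-(Complex.I • y)) 0

open Classical in
/-- The unitary group `e^{-itA}` of a self-adjoint operator `A`
(with the value `0` if `-iA` generates no unitary group). -/
def expNegI (A : E →ₗ.[ℂ] E) : ℝ → E →L[ℂ] E :=
  if h : ∃ U, IsUnitaryGroupOf A U then h.choose else 0

open Classical in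
/-- The vector `(A - z)⁻¹ ψ`, i.e. the `φ` in the domain of `A` with `A φ - z φ = ψ`;
for self-adjoint `A` and non-real `z` there is exactly one. -/
def resolventApply (A : E →ₗ.[ℂ] E) (z : ℂ) (ψ : E) : E :=
  if h : ∃ φ : A.domain, A φ - z • (φ : E) = ψ then (h.choose : E) else 0

/-- `m(z) = ⟨(A - z)⁻¹ ψ, ψ⟩` (the inner product of Mathlib is linear in its second slot). -/
def borelTransform (A : E →ₗ.[ℂ] E) (ψ : E) (z : ℂ) : ℂ :=
  inner ℂ ψ (resolventApply A z ψ)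

/-- `μ` is the spectral measure of `ψ` and `A`: the finite Borel measure on `ℝ` with
`⟨(A - z)⁻¹ ψ, ψ⟩ = ∫ dμ(x) / (x - z)` for all non-real `z`. For self-adjoint `A` there is exactly
one such measure. -/
structure IsSpectralMeasure (A : E →ₗ.[ℂ] E) (ψ : E) (μ : Measure ℝ) : Prop where
  finite : IsFiniteMeasure μ
  transform : ∀ z : ℂ, z.im ≠ 0 → borelTransform A ψ z = ∫ x : ℝ, ((x : ℂ) - z)⁻¹ ∂μ

open Classical in
/-- The spectral measure of the vector `ψ` and the self-adjoint operator `A`. -/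
def spectralMeasure (A : E →ₗ.[ℂ] E) (ψ : E) : Measure ℝ :=
  if h : ∃ μ, IsSpectralMeasure A ψ μ then h.choose else 0

end Abstract

/-! ## The half-line operator -/

/-- The Hilbert space `ℓ²(ℤ₊)`, `ℤ₊ = {1, 2, …}`. -/
abbrev HalfLine : Type := lp (fun _ : ℕ+ => ℂ) 2

/-- A function on `ℤ₊` extended to `n = 0` by zero (Dirichlet boundary condition). -/
def ext (u : ℕ+ → ℂ) (n : ℕ) : ℂ := if h : 0 < n then u (n.toPNat h) else 0

/-- The difference expression `a(n) u(n+1) + a(n-1) u(n-1) + b(n) u(n)`, `n ≥ 1`. -/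
def formal (a b : ℕ → ℝ) (u : ℕ+ → ℂ) (n : ℕ+) : ℂ :=
  a n * ext u (n + 1) + a (n - 1) * ext u (n - 1) + b n * ext u n

theorem ext_add (u v : ℕ+ → ℂ) (n : ℕ) : ext (u + v) n = ext u n + ext v n := by
  unfold ext; split <;> simp

theorem ext_smul (c : ℂ) (u : ℕ+ → ℂ) (n : ℕ) : ext (c • u) n = c * ext u n := by
  unfold ext; split <;> simp

theorem formal_add (a b : ℕ → ℝ) (u v : ℕ+ → ℂ) :
    formal a b (u + v) = formal a b u + formal a b v := by
  funext n; simp only [formal, ext_add, Pi.add_apply]; ring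

theorem formal_smul (a b : ℕ → ℝ) (c : ℂ) (u : ℕ+ → ℂ) :
    formal a b (c • u) = c • formal a b u := by
  funext n; simp only [formal, ext_smul, Pi.smul_apply, smul_eq_mul]; ring

theorem formal_zero (a b : ℕ → ℝ) : formal a b 0 = 0 := by
  have h := formal_smul a b 0 0
  simpa using h

/-- The half-line Jacobi operator `H₊` with Dirichlet boundary condition: it acts by the difference
expression on its maximal domain, all `u ∈ ℓ²(ℤ₊)` that the expression maps into `ℓ²(ℤ₊)`.
If `∑ 1/|a(n)| = ∞`, this is the self-adjoint closure of its restriction to finitely supported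
vectors. -/
def halfLineOp (a b : ℕ → ℝ) : HalfLine →ₗ.[ℂ] HalfLine where
  domain :=
    { carrier := {u | Memℓp (formal a b u) 2}
      add_mem' := fun {u v} hu hv => by
        have h : formal a b ⇑(u + v) = formal a b u + formal a b v := by
          rw [lp.coeFn_add, formal_add]
        change Memℓp (formal a b ⇑(u + v)) 2
        rw [h]; exact Memℓp.add hu hv
      zero_mem' := by
        change Memℓp (formal a b ⇑(0 : HalfLine)) 2
        rw [lp.coeFn_zero, formal_zero]; exact zero_memℓp
      smul_mem' := fun c u hu => by
        have h : formal a b ⇑(c • u) = c • formal a b u := by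
          rw [lp.coeFn_smul, formal_smul]
        change Memℓp (formal a b ⇑(c • u)) 2
        rw [h]; exact Memℓp.const_smul hu c }
  toFun :=
    { toFun := fun u => ⟨formal a b u.1, u.2⟩
      map_add' := fun u v => Subtype.ext (formal_add a b u.1 v.1)
      map_smul' := fun c u => Subtype.ext (formal_smul a b c u.1) }

/-- The initial vector `δ₁`. -/
def delta1 : HalfLine := lp.single 2 (1 : ℕ+) (1 : ℂ)

/-- The spectral measure `μ⁺` of `H₊` (and the vector `δ₁`). -/
def muPlus (a b : ℕ → ℝ) : Measure ℝ := spectralMeasure (halfLineOp a b) delta1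

/-- `‖φ‖_L² = ∑_{n=1}^{⌊L⌋} |φ(n)|² + (L - ⌊L⌋) |φ(⌊L⌋+1)|²`, for `L ≥ 0`. -/
def truncNormSq (L : ℝ) (φ : ℕ+ → ℂ) : ℝ :=
  ∑ n ∈ Finset.Icc 1 ⌊L⌋₊, ‖ext φ n‖ ^ 2 + (L - ⌊L⌋₊) * ‖ext φ (⌊L⌋₊ + 1)‖ ^ 2

/-- The time average `⟨A(t)⟩_T = (2/T) ∫₀^∞ e^{-2t/T} A(t) dt`. -/
def timeAvg (T : ℝ) (A : ℝ → ℝ) : ℝ :=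
  2 / T * ∫ t in Set.Ioi (0 : ℝ), Real.exp (-2 * t / T) * A t

/-! ## Generalized eigenfunctions, transfer matrices and the length scale -/

/-- The solution `u_θ(n, E)`, `n ≥ 0`, of `a(n) u(n+1) + a(n-1) u(n-1) + b(n) u(n) = E u(n)`,
`n ≥ 1`, with `u(0) = sin θ`, `u(1) = cos θ` (where `a` has no zeros). -/
def uSol (a b : ℕ → ℝ) (θ E : ℝ) : ℕ → ℝ
  | 0 => Real.sin θ
  | 1 => Real.cos θ
  | n + 2 => ((E - b (n + 1)) * uSol a b θ E (n + 1) - a n * uSol a b θ E n) / a (n + 1)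

theorem uSol_eq (a b : ℕ → ℝ) (ha : ∀ n, a n ≠ 0) (θ E : ℝ) (n : ℕ) (hn : 1 ≤ n) :
    a n * uSol a b θ E (n + 1) + a (n - 1) * uSol a b θ E (n - 1) + b n * uSol a b θ E n
      = E * uSol a b θ E n := by
  obtain ⟨k, rfl⟩ : ∃ k, n = k + 1 := ⟨n - 1, by omega⟩
  have h := ha (k + 1)
  simp only [uSol, Nat.add_sub_cancel]
  field_simp
  ring

/-- The transfer matrix `Φ(n, E)` from the site `0` to `n`. -/
def transfer (a b : ℕ → ℝ) (n : ℕ) (E : ℝ) : Matrix (Fin 2) (Fin 2) ℝ :=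
  !![uSol a b 0 E (n + 1), uSol a b (Real.pi / 2) E (n + 1);
     uSol a b 0 E n, uSol a b (Real.pi / 2) E n]

/-- The operator norm of a `2 × 2` matrix acting on the Euclidean plane. -/
def opNorm (M : Matrix (Fin 2) (Fin 2) ℝ) : ℝ := ‖Matrix.toEuclideanCLM (𝕜 := ℝ) M‖

/-- `‖Φ(E)‖_L`, where
`‖Φ(E)‖_L² = ∑_{n=1}^{⌊L⌋-1} ‖Φ(n,E)‖² + (L - ⌊L⌋) ‖Φ(⌊L⌋,E)‖²`, for `L ≥ 1`. -/
def transferNorm (a b : ℕ → ℝ) (E L : ℝ) : ℝ :=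
  √(∑ n ∈ Finset.Icc 1 (⌊L⌋₊ - 1), opNorm (transfer a b n E) ^ 2
    + (L - ⌊L⌋₊) * opNorm (transfer a b ⌊L⌋₊ E) ^ 2)

/-- The length scale `L̃⁺_ε(E)`: the `L ≥ 1` with `‖Φ(E)‖_L = 2 ‖Φ(1,E)⁻¹‖ ε⁻¹`. Exactly one `L`
satisfies this, for `ε > 0`, if `a` has no zeros and `∑ 1/|a(n)| = ∞`; so the infimum below is
that `L`. -/
def scaleTilde (a b : ℕ → ℝ) (ε E : ℝ) : ℝ :=
  sInf {L : ℝ | 1 ≤ L ∧ transferNorm a b E L = 2 * opNorm (transfer a b 1 E)⁻¹ * ε⁻¹}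

end JacobiDyn

end

noncomputable section

namespace JacobiDyn

open MeasureTheory Filter Topology

/-! ## Symmetric operators and their resolvents -/

section Resolvent

variable {E : Type*} [NormedAddCommGroup E] [InnerProductSpace ℂ E]

/-! Put ε = 1/T, z = E + iε and φ_E = (H₊ - z)⁻¹δ₁. Up to the factor i, φ_E is the one-sided Fourier
transform in E of e^{-εt} e^{-itH₊}δ₁, so Plancherel at each site turns the time average into (ε/π)
∫ ‖φ_E‖_L² dE (`timeAvg_truncNormSq`). On the other hand M(E) = Im φ_E(1) = ε‖φ_E‖² is the Poisson
integral of μ⁺, and the Poisson kernel centred at x has mass at least 1 over |E - x| ≤ ε. Hence it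
suffices that M(E) ≤ 8ε‖φ_E‖_L² whenever |E - x| ≤ ε and the length scale at x is at most L:
integrating in E then gives μ⁺(S) ≤ 8ε ∫ ‖φ_E‖_L² dE for the set S of such x
(`measureReal_le_integral`).

That pointwise bound is `im_le_truncSq`. Extended by u(0) = -1, the resolvent vector u solves the
homogeneous equation at z. Let c(n) be the coordinates of (u(n+1), u(n)) in the basis of real
solutions at energy x. If the mass of u up to the length scale were too small, variation of
parameters and Cauchy–Schwarz would keep c(n) bounded, while the flux -a(n) Im(u(n+1) ū(n)) would
stay above M/2. The flux is the determinant of (Re c, Im c), so these two real vectors stay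
quantitatively independent and Φ(n,x) is controlled by its values on them, that is by u(n+1) and
u(n). Summing over n makes ‖Φ‖_L smaller than its prescribed value, a contradiction.

Divergence of ∑ 1/|a(n)| enters twice: it kills the boundary term in Green's formula, which gives
self-adjointness, and since det Φ(n) = 1/a(n) it makes ‖Φ‖_L unbounded, so that the length scale
exists. The group and the spectral measure are chosen objects whose defining properties are all that
matters, so only their existence is needed; it comes from the continuous functional calculus of the
bounded normal operator (A - i)⁻¹. -/

/-- `A` is symmetric: `⟨A x, x'⟩ = ⟨x, A x'⟩` on the domain of `A`. -/
def IsSymmetricOp (A : E →ₗ.[ℂ] E) : Prop :=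
  ∀ x y x' y' : E, (x, y) ∈ A.graph → (x', y') ∈ A.graph → inner ℂ y x' = inner ℂ x y'

/-- `A - w` maps the domain of `A` onto the whole space. -/
def IsOntoAt (A : E →ₗ.[ℂ] E) (w : ℂ) : Prop :=
  ∀ ψ : E, ∃ φ : E, (φ, ψ + w • φ) ∈ A.graph

/-- Since ⟨Aφ, φ⟩ is real, only the term w‖φ‖² contributes an imaginary part. For ψ = δ₁ this is the
identity Im m(z) = Im z · ‖φ‖². -/
theorem IsSymmetricOp.im_inner {A : E →ₗ.[ℂ] E} (hA : IsSymmetricOp A) {w : ℂ} {φ ψ : E}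
    (h : (φ, ψ + w • φ) ∈ A.graph) : (inner ℂ ψ φ).im = w.im * ‖φ‖ ^ 2 := by
  have h1 := hA _ _ _ _ h h
  rw [inner_add_left, inner_add_right, inner_smul_left, inner_smul_right,
    ← inner_conj_symm φ ψ] at h1
  have h2 := congrArg Complex.im h1
  have h3 : (inner ℂ φ φ : ℂ) = ((‖φ‖ ^ 2 : ℝ) : ℂ) := by
    rw [inner_self_eq_norm_sq_to_K]; norm_cast
  rw [h3] at h2
  simp only [Complex.add_im, Complex.mul_im, Complex.conj_re, Complex.conj_im, Complex.ofReal_re,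
    Complex.ofReal_im] at h2
  linarith

theorem IsSymmetricOp.norm_le {A : E →ₗ.[ℂ] E} (hA : IsSymmetricOp A) {w : ℂ} {φ ψ : E}
    (h : (φ, ψ + w • φ) ∈ A.graph) : |w.im| * ‖φ‖ ≤ ‖ψ‖ := by
  rcases eq_or_ne φ 0 with rfl | h0
  · simp
  have h1 : |(inner ℂ ψ φ).im| ≤ ‖ψ‖ * ‖φ‖ :=
    (Complex.abs_im_le_norm _).trans (norm_inner_le_norm _ _)
  rw [hA.im_inner h, abs_mul, abs_of_nonneg (sq_nonneg ‖φ‖)] at h1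
  have h2 : 0 < ‖φ‖ := norm_pos_iff.2 h0
  exact le_of_mul_le_mul_right (by nlinarith) h2

theorem graph_sub {A : E →ₗ.[ℂ] E} {w : ℂ} {φ ψ φ' ψ' : E}
    (h : (φ, ψ + w • φ) ∈ A.graph) (h' : (φ', ψ' + w • φ') ∈ A.graph) :
    (φ - φ', (ψ - ψ') + w • (φ - φ')) ∈ A.graph := by
  have h1 := A.graph.sub_mem h h'
  have h2 : (φ, ψ + w • φ) - (φ', ψ' + w • φ') = (φ - φ', (ψ - ψ') + w • (φ - φ')) := by
    rw [Prod.mk_sub_mk, smul_sub]; congr 1; module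
  rwa [h2] at h1

theorem IsSymmetricOp.unique {A : E →ₗ.[ℂ] E} (hA : IsSymmetricOp A) {w : ℂ} (hw : w.im ≠ 0)
    {φ φ' ψ : E} (h : (φ, ψ + w • φ) ∈ A.graph) (h' : (φ', ψ + w • φ') ∈ A.graph) : φ = φ' := by
  have h1 := hA.norm_le (graph_sub h h')
  rw [sub_self, norm_zero] at h1
  have h2 : ‖φ - φ'‖ ≤ 0 := by
    by_contra! h3
    exact absurd h1 (not_le.2 (mul_pos (abs_pos.2 hw) h3))
  exact sub_eq_zero.1 (norm_le_zero_iff.1 h2)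

/-- The bounded resolvent of a symmetric operator at a non-real point where it is onto. -/
theorem IsSymmetricOp.exists_resolvent {A : E →ₗ.[ℂ] E} (hA : IsSymmetricOp A) {w : ℂ}
    (hw : w.im ≠ 0) (hs : IsOntoAt A w) :
    ∃ R : E →L[ℂ] E, ∀ ψ, (R ψ, ψ + w • R ψ) ∈ A.graph := by
  choose f hf using hs
  have hadd : ∀ x y, f (x + y) = f x + f y := fun x y => by
    refine hA.unique hw (hf (x + y)) ?_
    have h1 := A.graph.add_mem (hf x) (hf y)
    have h2 : (f x, x + w • f x) + (f y, y + w • f y)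
        = (f x + f y, (x + y) + w • (f x + f y)) := by
      rw [Prod.mk_add_mk, smul_add]; congr 1; module
    rwa [h2] at h1
  have hsmul : ∀ (c : ℂ) x, f (c • x) = c • f x := fun c x => by
    refine hA.unique hw (hf (c • x)) ?_
    have h1 := A.graph.smul_mem c (hf x)
    have h2 : c • (f x, x + w • f x) = (c • f x, c • x + w • (c • f x)) := by
      rw [Prod.smul_mk, smul_add, smul_comm]
    rwa [h2] at h1
  refine ⟨LinearMap.mkContinuous ⟨⟨f, hadd⟩, hsmul⟩ |w.im|⁻¹ fun x => ?_, hf⟩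
  rw [inv_mul_eq_div, le_div_iff₀ (abs_pos.2 hw), mul_comm]
  exact hA.norm_le (hf x)

theorem resolventApply_eq {A : E →ₗ.[ℂ] E} (hA : IsSymmetricOp A) {z : ℂ} (hz : z.im ≠ 0)
    {φ ψ : E} (h : (φ, ψ + z • φ) ∈ A.graph) : resolventApply A z ψ = φ := by
  have key : ∀ y : A.domain, A y - z • (y : E) = ψ → ((y : E), ψ + z • (y : E)) ∈ A.graph := by
    intro y hy
    rw [LinearPMap.mem_graph_iff]
    exact ⟨y, rfl, by rw [← hy, sub_add_cancel]⟩
  have hex : ∃ y : A.domain, A y - z • (y : E) = ψ := by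
    obtain ⟨y, h1, h2⟩ := (LinearPMap.mem_graph_iff _).1 h
    simp only at h1 h2
    exact ⟨y, by rw [h2, h1, add_sub_cancel_right]⟩
  rw [resolventApply, dif_pos hex]
  exact hA.unique hz (key _ hex.choose_spec) h

end Resolvent

/-! ### The resolvent at i as a bounded normal operator. -/

section Normal

variable {E : Type*} [NormedAddCommGroup E] [InnerProductSpace ℂ E] [CompleteSpace E]

/-- The resolvent `R = (A - i)⁻¹` of a self-adjoint operator, together with the facts about it on
which the functional calculus of `A` rests. -/
structure IsResolventI (A : E →ₗ.[ℂ] E) (R : E →L[ℂ] E) : Prop where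
  symm : IsSymmetricOp A
  mem : ∀ ψ, (R ψ, ψ + Complex.I • R ψ) ∈ A.graph
  normal : IsStarNormal R
  star_mul : R - star R = (2 * Complex.I) • (star R * R)
  dense : DenseRange R

theorem exists_isResolventI {A : E →ₗ.[ℂ] E} (hA : IsSymmetricOp A)
    (h1 : IsOntoAt A Complex.I) (h2 : IsOntoAt A (-Complex.I)) : ∃ R, IsResolventI A R := by
  obtain ⟨R, hR⟩ := hA.exists_resolvent (by simp) h1
  obtain ⟨S, hS⟩ := hA.exists_resolvent (by simp) h2
  have hSR : star R = S := by
    rw [ContinuousLinearMap.star_eq_adjoint]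
    symm
    rw [ContinuousLinearMap.eq_adjoint_iff]
    intro x y
    have h := hA _ _ _ _ (hS x) (hR y)
    rw [inner_add_left, inner_add_right, inner_smul_left, inner_smul_right] at h
    simp only [map_neg, Complex.conj_I, neg_neg] at h
    exact (add_right_cancel h).symm
  -- The resolvent identity in both orders of the factors; comparing the two shows that `R` commutes
  -- with its adjoint `S`.
  have hRS : ∀ ψ, R ψ - S ψ = (2 * Complex.I) • R (S ψ) := by
    intro ψ
    have h : (S ψ, (ψ - (2 * Complex.I) • S ψ) + Complex.I • S ψ) ∈ A.graph := by
      convert hS ψ using 2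
      module
    have h3 := hA.unique (by simp) h (hR (ψ - (2 * Complex.I) • S ψ))
    rw [map_sub, map_smul] at h3
    exact sub_eq_of_eq_add' (eq_sub_iff_add_eq.1 h3).symm
  have hSR' : ∀ ψ, R ψ - S ψ = (2 * Complex.I) • S (R ψ) := by
    intro ψ
    have h : (R ψ, (ψ + (2 * Complex.I) • R ψ) + (-Complex.I) • R ψ) ∈ A.graph := by
      convert hR ψ using 2
      module
    have h3 := hA.unique (by simp) h (hS (ψ + (2 * Complex.I) • R ψ))
    rw [map_add, map_smul] at h3
    exact sub_eq_of_eq_add' h3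
  refine ⟨R, hA, hR, ⟨?_⟩, ?_, ?_⟩
  · rw [hSR]
    ext ψ
    have h3 := (hRS ψ).symm.trans (hSR' ψ)
    have h4 : (2 * Complex.I) ≠ 0 := by simp
    exact (smul_right_injective E h4 h3).symm
  · ext ψ
    rw [hSR]
    exact hSR' ψ
  · have h3 : (LinearMap.range R.toLinearMap).topologicalClosure = ⊤ := by
      rw [Submodule.topologicalClosure_eq_top_iff, Submodule.eq_bot_iff]
      intro w hw
      -- A vector orthogonal to the range of `R` is killed by its adjoint `S`, and (0, w) lies in a
      -- graph only for w = 0.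
      have h4 : S w = 0 := by
        refine ext_inner_right ℂ fun v => ?_
        rw [← hSR, ContinuousLinearMap.star_eq_adjoint, ContinuousLinearMap.adjoint_inner_left,
          inner_zero_left, ← inner_conj_symm,
          show inner ℂ (R v) w = 0 from (Submodule.mem_orthogonal _ _).1 hw _ ⟨v, rfl⟩, map_zero]
      have h5 := hS w
      rw [h4, smul_zero, add_zero] at h5
      exact A.graph_fst_eq_zero_snd h5 rfl
    intro x
    have h6 : x ∈ (LinearMap.range R.toLinearMap).topologicalClosure := by rw [h3]; trivial
    rw [← SetLike.mem_coe, Submodule.topologicalClosure_coe] at h6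
    exact h6

end Normal

/-! ## The functional calculus of the resolvent -/

/-- `e^{-itx} (x - i)⁻¹` as a function of `r = (x - i)⁻¹`. -/
def phase (t : ℝ) (r : ℂ) : ℂ := Complex.exp (Complex.I * (-(t * (r⁻¹).re) : ℝ)) * r

theorem norm_exp_I_mul_sub_le (y : ℝ) : ‖Complex.exp (Complex.I * y) - 1‖ ≤ |y| :=
  Real.norm_exp_I_mul_ofReal_sub_one_le

theorem norm_exp_I_mul_sub_sub_le (y : ℝ) :
    ‖Complex.exp (Complex.I * y) - 1 - Complex.I * y‖ ≤ 2 * |y| := by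
  refine (norm_sub_le _ _).trans ?_
  have h := norm_exp_I_mul_sub_le y
  simp only [norm_mul, Complex.norm_I, Complex.norm_real, Real.norm_eq_abs, one_mul]
  linarith

theorem norm_exp_I_mul_sub_sub_le_sq (y : ℝ) :
    ‖Complex.exp (Complex.I * y) - 1 - Complex.I * y‖ ≤ 2 * y ^ 2 := by
  have hn : ‖Complex.I * (y : ℂ)‖ = |y| := by simp
  rcases le_total |y| 1 with h | h
  · have h1 := Complex.norm_exp_sub_one_sub_id_le (x := Complex.I * y) (by rwa [hn])
    rw [hn, sq_abs] at h1
    nlinarith [sq_nonneg y]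
  · refine (norm_exp_I_mul_sub_sub_le y).trans ?_
    rw [← sq_abs]; nlinarith

theorem norm_exp_I_mul (y : ℝ) : ‖Complex.exp (Complex.I * y)‖ = 1 := by
  rw [mul_comm]; exact Complex.norm_exp_ofReal_mul_I y

theorem norm_phase (t : ℝ) (r : ℂ) : ‖phase t r‖ = ‖r‖ := by
  rw [phase, norm_mul, norm_exp_I_mul, one_mul]

theorem phase_zero_left (r : ℂ) : phase 0 r = r := by simp [phase]

theorem phase_mul_phase (s t : ℝ) (r : ℂ) : phase s r * phase t r = phase (s + t) r * r := by
  have h : Complex.exp (Complex.I * (-((s + t) * (r⁻¹).re) : ℝ))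
      = Complex.exp (Complex.I * (-(s * (r⁻¹).re) : ℝ))
        * Complex.exp (Complex.I * (-(t * (r⁻¹).re) : ℝ)) := by
    rw [← Complex.exp_add]; congr 1; push_cast; ring
  simp only [phase, h]; ring

/-- The factor r is what makes this true: e^{-itx} alone has no limit as x → ±∞, which is the point
r = 0. -/
theorem continuous_phase (t : ℝ) : Continuous (phase t) := by
  rw [continuous_iff_continuousAt]
  intro r
  rcases eq_or_ne r 0 with rfl | hr
  · rw [ContinuousAt, show phase t 0 = 0 by simp [phase], tendsto_zero_iff_norm_tendsto_zero]
    simp only [norm_phase]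
    exact tendsto_norm_zero
  · have h : ContinuousAt (fun r : ℂ => r⁻¹) r := continuousAt_inv₀ hr
    have h1 : ContinuousAt (fun r : ℂ => (-(t * (r⁻¹).re) : ℝ)) r :=
      (continuousAt_const.mul (Complex.continuous_re.continuousAt.comp h)).neg
    have h2 : ContinuousAt (fun r : ℂ => ((-(t * (r⁻¹).re) : ℝ) : ℂ)) r :=
      Complex.continuous_ofReal.continuousAt.comp h1
    exact ((continuousAt_const.mul h2).cexp).mul continuousAt_id

theorem abs_re_inv_mul_norm_le (r : ℂ) : |(r⁻¹).re| * ‖r‖ ≤ 1 := by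
  refine (mul_le_mul_of_nonneg_right (Complex.abs_re_le_norm _) (norm_nonneg r)).trans ?_
  rw [norm_inv]; exact inv_mul_le_one

theorem norm_phase_sub_phase_le (s t : ℝ) (r : ℂ) : ‖phase t r - phase s r‖ ≤ |t - s| := by
  have h : Complex.exp (Complex.I * (-(t * (r⁻¹).re) : ℝ))
      = Complex.exp (Complex.I * (-(s * (r⁻¹).re) : ℝ))
        * Complex.exp (Complex.I * (-((t - s) * (r⁻¹).re) : ℝ)) := by
    rw [← Complex.exp_add]; congr 1; push_cast; ring
  have h2 : phase t r - phase s r = Complex.exp (Complex.I * (-(s * (r⁻¹).re) : ℝ))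
      * (Complex.exp (Complex.I * (-((t - s) * (r⁻¹).re) : ℝ)) - 1) * r := by
    simp only [phase, h]; ring
  rw [h2, norm_mul, norm_mul, norm_exp_I_mul, one_mul]
  calc _ ≤ |-((t - s) * (r⁻¹).re)| * ‖r‖ := by gcongr; exact norm_exp_I_mul_sub_le _
    _ = |t - s| * (|(r⁻¹).re| * ‖r‖) := by rw [abs_neg, abs_mul, mul_assoc]
    _ ≤ |t - s| * 1 := by gcongr; exact abs_re_inv_mul_norm_le r
    _ = _ := mul_one _

/-- The circle `{(x - i)⁻¹ : x ∈ ℝ} ∪ {0}`. -/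
def OnCircle (r : ℂ) : Prop := ‖r‖ ^ 2 = r.im

theorem OnCircle.inv_eq {r : ℂ} (h : OnCircle r) (h0 : r ≠ 0) :
    r⁻¹ = ((r⁻¹).re : ℂ) - Complex.I := by
  have h1 : Complex.normSq r ≠ 0 := by simpa using h0
  have h2 : Complex.normSq r = r.im := by rw [Complex.normSq_eq_norm_sq]; exact h
  apply Complex.ext
  · simp
  · simp only [Complex.inv_im, Complex.sub_im, Complex.ofReal_im, Complex.I_im, h2]
    rw [h2] at h1
    field_simp; ring

/-- On the circle x r = 1 + i r, the symbol of A(A - i)⁻¹, so the left side is the first order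
Taylor remainder of e^{-itx} times r. The next two lemmas bound it uniformly by O(t), and by O(t²)
after one more factor r. -/
theorem phase_sub_eq {r : ℂ} (h : OnCircle r) (h0 : r ≠ 0) (t : ℝ) :
    phase t r - r + (t * Complex.I) * (1 + Complex.I * r)
      = (Complex.exp (Complex.I * (-(t * (r⁻¹).re) : ℝ)) - 1
          - Complex.I * (-(t * (r⁻¹).re) : ℝ)) * r := by
  have h1 : ((r⁻¹).re : ℂ) * r = 1 + Complex.I * r := by
    have h2 : r⁻¹ * r = 1 := inv_mul_cancel₀ h0
    rw [h.inv_eq h0] at h2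
    linear_combination h2
  rw [← h1, phase]; push_cast; ring

theorem norm_phase_sub_le {r : ℂ} (h : OnCircle r) (t : ℝ) :
    ‖phase t r - r + (t * Complex.I) * (1 + Complex.I * r)‖ ≤ 2 * |t| := by
  rcases eq_or_ne r 0 with rfl | h0
  · simp only [phase, mul_zero, sub_zero, zero_add, add_zero, mul_one, norm_mul, Complex.norm_real,
      Complex.norm_I, Real.norm_eq_abs]
    linarith [abs_nonneg t]
  · rw [phase_sub_eq h h0, norm_mul]
    calc _ ≤ (2 * |-(t * (r⁻¹).re)|) * ‖r‖ := by gcongr; exact norm_exp_I_mul_sub_sub_le _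
      _ = (2 * |t|) * (|(r⁻¹).re| * ‖r‖) := by rw [abs_neg, abs_mul]; ring
      _ ≤ (2 * |t|) * 1 := by gcongr; exact abs_re_inv_mul_norm_le r
      _ = _ := mul_one _

theorem norm_phase_sub_mul_le {r : ℂ} (h : OnCircle r) (t : ℝ) :
    ‖(phase t r - r + (t * Complex.I) * (1 + Complex.I * r)) * r‖ ≤ 2 * t ^ 2 := by
  rcases eq_or_ne r 0 with rfl | h0
  · rw [mul_zero, norm_zero]; positivity
  · rw [phase_sub_eq h h0, norm_mul, norm_mul]
    calc _ ≤ (2 * (-(t * (r⁻¹).re)) ^ 2) * ‖r‖ * ‖r‖ := by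
          gcongr; exact norm_exp_I_mul_sub_sub_le_sq _
      _ = (2 * t ^ 2) * (|(r⁻¹).re| * ‖r‖) ^ 2 := by rw [mul_pow, sq_abs]; ring
      _ ≤ (2 * t ^ 2) * 1 := by
          gcongr
          exact pow_le_one₀ (by positivity) (abs_re_inv_mul_norm_le r)
      _ = _ := mul_one _

section

variable {E : Type*} [NormedAddCommGroup E] [InnerProductSpace ℂ E] [CompleteSpace E]
variable {A : E →ₗ.[ℂ] E} {R : E →L[ℂ] E}

/-- The operator identity R - R* = 2i R*R passes to the spectrum as r - r̄ = 2i|r|². -/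
theorem IsResolventI.onCircle (h : IsResolventI A R) {r : ℂ} (hr : r ∈ spectrum ℂ R) :
    OnCircle r := by
  have := h.normal
  have h1 : cfc (fun r : ℂ => r - star r) R
      = cfc (fun r : ℂ => (2 * Complex.I) • (star r * r)) R := by
    rw [cfc_sub (fun r : ℂ => r) (fun r => star r) R, cfc_id' ℂ R, cfc_star_id R,
      cfc_smul (2 * Complex.I) (fun r : ℂ => star r * r) R,
      cfc_mul (fun r : ℂ => star r) (fun r => r) R, cfc_id' ℂ R, cfc_star_id R]
    exact h.star_mul
  have h2 := (cfc_eq_cfc_iff_eqOn h.normal (by fun_prop) (by fun_prop)).1 h1 hr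
  have h3 := congrArg Complex.im h2
  simp only [Complex.sub_im, RCLike.star_def, Complex.conj_im, smul_eq_mul,
    Complex.conj_mul', Complex.mul_im, Complex.mul_re] at h3
  have h4 : ((‖r‖ : ℂ) ^ 2).re = ‖r‖ ^ 2 := by norm_cast
  have h5 : ((‖r‖ : ℂ) ^ 2).im = 0 := by norm_cast
  rw [h4, h5] at h3
  simp at h3
  unfold OnCircle; linarith

/-- `e^{-itA} (A - i)⁻¹`. -/
def phaseOp (R : E →L[ℂ] E) (t : ℝ) : E →L[ℂ] E := cfc (phase t) R

theorem phaseOp_zero [IsStarNormal R] : phaseOp R 0 = R := by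
  have h : phase 0 = fun r => r := funext phase_zero_left
  rw [phaseOp, h, cfc_id' ℂ R]

theorem phaseOp_mul_phaseOp [IsStarNormal R] (s t : ℝ) :
    phaseOp R s * phaseOp R t = phaseOp R (s + t) * R := by
  have h : (fun r => phase s r * phase t r) = fun r => phase (s + t) r * r :=
    funext (phase_mul_phase s t)
  rw [phaseOp, phaseOp, ← cfc_mul (phase s) (phase t) R (continuous_phase s).continuousOn
    (continuous_phase t).continuousOn, h,
    cfc_mul (phase (s + t)) (fun r => r) R (continuous_phase _).continuousOn, cfc_id' ℂ R, phaseOp]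

theorem commute_phaseOp [IsStarNormal R] (t : ℝ) (x : E) :
    phaseOp R t (R x) = R (phaseOp R t x) := by
  have h := cfc_commute_cfc (phase t) (fun r => r) R
  rw [cfc_id' ℂ R] at h
  exact DFunLike.congr_fun h.eq x

theorem norm_phaseOp_apply [IsStarNormal R] (t : ℝ) (x : E) : ‖phaseOp R t x‖ = ‖R x‖ := by
  have h1 : star (phaseOp R t) * phaseOp R t = star R * R := by
    have h : (fun r => star (phase t r) * phase t r) = fun r => star r * r := by
      funext r
      simp only [RCLike.star_def, Complex.conj_mul', norm_phase]
    rw [phaseOp, ← cfc_star, ← cfc_mul (fun r => star (phase t r)) (phase t) R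
      (continuous_phase t).star.continuousOn (continuous_phase t).continuousOn, h,
      cfc_mul (fun r : ℂ => star r) (fun r => r) R, cfc_id' ℂ R, cfc_star_id R]
  have h2 : ∀ B : E →L[ℂ] E, (inner ℂ ((star B * B) x) x : ℂ) = ((‖B x‖ ^ 2 : ℝ) : ℂ) := by
    intro B
    rw [ContinuousLinearMap.star_eq_adjoint, mul_apply_eq_comp,
      ContinuousLinearMap.adjoint_inner_left, inner_self_eq_norm_sq_to_K]
    norm_cast
  have h3 := h2 (phaseOp R t)
  rw [h1, h2 R] at h3
  have h4 : ‖R x‖ ^ 2 = ‖phaseOp R t x‖ ^ 2 := by exact_mod_cast h3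
  exact ((sq_eq_sq₀ (norm_nonneg _) (norm_nonneg _)).1 h4).symm

theorem norm_phaseOp_sub_le [IsStarNormal R] (s t : ℝ) : ‖phaseOp R t - phaseOp R s‖ ≤ |t - s| := by
  rw [phaseOp, phaseOp, ← cfc_sub (phase t) (phase s) R (continuous_phase t).continuousOn
    (continuous_phase s).continuousOn]
  exact norm_cfc_le (abs_nonneg _) fun r _ => norm_phase_sub_phase_le s t r

/-- The error of the first order expansion of `e^{-itA} (A - i)⁻¹` at `t = 0`. -/
def phaseErr (R : E →L[ℂ] E) (t : ℝ) : E →L[ℂ] E :=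
  cfc (fun r => phase t r - r + (t * Complex.I) * (1 + Complex.I * r)) R

theorem continuous_phaseErr_symbol (t : ℝ) :
    Continuous fun r => phase t r - r + (t * Complex.I) * (1 + Complex.I * r) := by
  have := continuous_phase t
  fun_prop

theorem phaseErr_eq [IsStarNormal R] (t : ℝ) :
    phaseErr R t = phaseOp R t - R + (t * Complex.I) • (1 + Complex.I • R) := by
  have h1 := continuous_phase t
  rw [phaseErr, cfc_add (a := R) (fun r => phase t r - r)
    (fun r => (t * Complex.I) * (1 + Complex.I * r)) (by fun_prop) (by fun_prop),
    cfc_sub (phase t) (fun r => r) R h1.continuousOn, cfc_id' ℂ R,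
    cfc_const_mul (t * Complex.I) (fun r => 1 + Complex.I * r) R,
    cfc_const_add 1 (fun r => Complex.I * r) R, cfc_const_mul Complex.I (fun r => r) R,
    cfc_id' ℂ R, phaseOp, map_one]

theorem IsResolventI.norm_phaseErr_le (h : IsResolventI A R) (t : ℝ) :
    ‖phaseErr R t‖ ≤ 2 * |t| :=
  norm_cfc_le (by positivity) fun _ hr => norm_phase_sub_le (h.onCircle hr) t

theorem IsResolventI.norm_phaseErr_mul_le (h : IsResolventI A R) (t : ℝ) :
    ‖phaseErr R t * R‖ ≤ 2 * t ^ 2 := by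
  have := h.normal
  have h1 : phaseErr R t * R
      = cfc (fun r => (phase t r - r + (t * Complex.I) * (1 + Complex.I * r)) * r) R := by
    rw [cfc_mul (fun r => phase t r - r + (t * Complex.I) * (1 + Complex.I * r)) (fun r => r) R
      (continuous_phaseErr_symbol t).continuousOn, cfc_id' ℂ R, phaseErr]
  rw [h1]
  exact norm_cfc_le (by positivity) fun _ hr => norm_phase_sub_mul_le (h.onCircle hr) t

end

/-! ## Stone's theorem -/

section

variable {E : Type*} [NormedAddCommGroup E] [InnerProductSpace ℂ E] [CompleteSpace E]
variable {A : E →ₗ.[ℂ] E} {R : E →L[ℂ] E}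

theorem inner_map_map_of_mem_unitary {V : E →L[ℂ] E} (hV : V ∈ unitary (E →L[ℂ] E)) (x y : E) :
    inner ℂ (V x) (V y) = inner ℂ x y := by
  rw [← ContinuousLinearMap.adjoint_inner_left, ← ContinuousLinearMap.star_eq_adjoint,
    ← mul_apply_eq_comp, (Unitary.mem_iff.1 hV).1]
  rfl

theorem norm_map_of_mem_unitary {V : E →L[ℂ] E} (hV : V ∈ unitary (E →L[ℂ] E)) (x : E) :
    ‖V x‖ = ‖x‖ := by
  rw [@norm_eq_sqrt_re_inner ℂ, inner_map_map_of_mem_unitary hV, ← @norm_eq_sqrt_re_inner ℂ]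

/-- ⟨U_t x, U_t x'⟩ does not depend on t; differentiate it at 0. -/
theorem inner_generator_comm {U : ℝ → E →L[ℂ] E} (hU : ∀ t, U t ∈ unitary (E →L[ℂ] E))
    (h0 : U 0 = 1) {x y x' y' : E} (h : HasDerivAt (fun t => U t x) (-(Complex.I • y)) 0)
    (h' : HasDerivAt (fun t => U t x') (-(Complex.I • y')) 0) : inner ℂ y x' = inner ℂ x y' := by
  have h1 := HasDerivAt.inner ℂ h h'
  have h2 : (fun t : ℝ => inner ℂ (U t x) (U t x')) = fun _ => inner ℂ x x' :=
    funext fun t => inner_map_map_of_mem_unitary (hU t) x x'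
  rw [h2, h0] at h1
  have h3 := h1.unique (hasDerivAt_const (0 : ℝ) (inner ℂ x x'))
  simp only [one_apply_eq_self, inner_neg_right, inner_neg_left, inner_smul_left,
    inner_smul_right, Complex.conj_I] at h3
  have h4 : Complex.I * (inner ℂ y x' - inner ℂ x y') = 0 := by linear_combination h3
  exact sub_eq_zero.1 ((mul_eq_zero.1 h4).resolve_left Complex.I_ne_zero)

/-- The unitary group `e^{-itA}`, defined on the range of `R = (A - i)⁻¹` by `phaseOp`. -/
def stoneGroup (R : E →L[ℂ] E) (t : ℝ) : E →L[ℂ] E :=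
  (phaseOp R t).toLinearMap.extendOfNorm R.toLinearMap

namespace IsResolventI

variable (h : IsResolventI A R)
include h

theorem stoneGroup_apply (t : ℝ) (x : E) : stoneGroup R t (R x) = phaseOp R t x := by
  have := h.normal
  exact LinearMap.extendOfNorm_eq (f := (phaseOp R t).toLinearMap) (e := R.toLinearMap) h.dense
    ⟨1, fun x => by rw [one_mul]; exact (norm_phaseOp_apply t x).le⟩ x

theorem norm_stoneGroup_le (t : ℝ) (x : E) : ‖stoneGroup R t x‖ ≤ ‖x‖ := by
  have := h.normal
  have h1 := LinearMap.norm_extendOfNorm_apply_le (f := (phaseOp R t).toLinearMap)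
    (e := R.toLinearMap) h.dense 1
    (fun x => by rw [one_mul]; exact (norm_phaseOp_apply t x).le) x
  rwa [one_mul] at h1

theorem ext_range {V W : E →L[ℂ] E} (hVW : ∀ x, V (R x) = W (R x)) : V = W := by
  apply DFunLike.coe_injective
  exact h.dense.equalizer V.continuous W.continuous (funext hVW)

theorem stoneGroup_zero : stoneGroup R 0 = 1 := by
  have := h.normal
  refine h.ext_range fun x => ?_
  rw [h.stoneGroup_apply, phaseOp_zero]; rfl

theorem stoneGroup_add (s t : ℝ) : stoneGroup R (s + t) = stoneGroup R s * stoneGroup R t := by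
  have := h.normal
  refine h.ext_range fun x => ?_
  rw [mul_apply_eq_comp, h.stoneGroup_apply, h.stoneGroup_apply]
  have h1 : phaseOp R (s + t) = stoneGroup R s * phaseOp R t := by
    refine h.ext_range fun y => ?_
    rw [mul_apply_eq_comp, commute_phaseOp t, h.stoneGroup_apply, ← mul_apply_eq_comp,
      ← mul_apply_eq_comp, phaseOp_mul_phaseOp]
  rw [h1, mul_apply_eq_comp]

theorem stoneGroup_mem_unitary (t : ℝ) : stoneGroup R t ∈ unitary (E →L[ℂ] E) := by
  have h1 : ∀ t, stoneGroup R (-t) * stoneGroup R t = 1 := fun t => by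
    rw [← h.stoneGroup_add, neg_add_cancel, h.stoneGroup_zero]
  have h2 : stoneGroup R t * stoneGroup R (-t) = 1 := by simpa using h1 (-t)
  have h3 : ∀ x, ‖stoneGroup R t x‖ = ‖x‖ := fun x => by
    refine le_antisymm (h.norm_stoneGroup_le t x) ?_
    have h4 := h.norm_stoneGroup_le (-t) (stoneGroup R t x)
    rwa [← mul_apply_eq_comp, h1] at h4
  -- `stoneGroup R t` and its inverse `stoneGroup R (-t)` are both contractions, so it is isometric;
  -- an invertible isometry is unitary.
  have h5 : star (stoneGroup R t) * stoneGroup R t = 1 :=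
    (ContinuousLinearMap.norm_map_iff_adjoint_comp_self _).1 h3
  refine Unitary.mem_iff.2 ⟨h5, ?_⟩
  rw [left_inv_eq_right_inv h5 h2]; exact h2

theorem continuous_stoneGroup (x : E) : Continuous fun t => stoneGroup R t x := by
  have := h.normal
  have h1 : ∀ y, Continuous fun t => stoneGroup R t (R y) := fun y => by
    have h2 : LipschitzWith ‖y‖₊ fun t => stoneGroup R t (R y) := by
      refine LipschitzWith.of_dist_le_mul fun t s => ?_
      rw [h.stoneGroup_apply, h.stoneGroup_apply, dist_eq_norm, Real.dist_eq,
        ← sub_apply, mul_comm]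
      exact ((phaseOp R t - phaseOp R s).le_opNorm y).trans
        (mul_le_mul_of_nonneg_right (norm_phaseOp_sub_le s t) (norm_nonneg y))
    exact h2.continuous
  rw [Metric.continuous_iff]
  intro s ε hε
  obtain ⟨y, hy⟩ := h.dense.exists_dist_lt x (show 0 < ε / 3 by positivity)
  obtain ⟨δ, hδ, hδ'⟩ := Metric.continuous_iff.1 (h1 y) s (ε / 3) (by positivity)
  refine ⟨δ, hδ, fun t ht => ?_⟩
  have h3 : ∀ t, dist (stoneGroup R t x) (stoneGroup R t (R y)) < ε / 3 := fun t => by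
    rw [dist_eq_norm, ← map_sub]
    exact (h.norm_stoneGroup_le t _).trans_lt (by rwa [← dist_eq_norm])
  have h4 := h3 t
  have h5 := h3 s
  have h6 := hδ' t ht
  rw [dist_comm] at h5
  linarith [dist_triangle4 (stoneGroup R t x) (stoneGroup R t (R y)) (stoneGroup R s (R y))
    (stoneGroup R s x)]

theorem hasDerivAt_stoneGroup (x : E) :
    HasDerivAt (fun t => stoneGroup R t (R x)) (-(Complex.I • (x + Complex.I • R x))) 0 := by
  have := h.normal
  have h1 : ∀ t : ℝ, stoneGroup R t (R x) - stoneGroup R 0 (R x)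
      - (t - 0) • (-(Complex.I • (x + Complex.I • R x))) = phaseErr R t x := fun t => by
    rw [phaseErr_eq, h.stoneGroup_apply, h.stoneGroup_apply, phaseOp_zero, sub_zero]
    simp only [add_apply, sub_apply,
      smul_apply, one_apply_eq_self]
    rw [smul_neg, sub_neg_eq_add, mul_smul]
    rfl
  rw [hasDerivAt_iff_isLittleO]
  simp only [h1]
  rw [Asymptotics.isLittleO_iff]
  intro c hc
  obtain ⟨y, hy⟩ := h.dense.exists_dist_lt x (show 0 < c / 4 by positivity)
  have h2 : ∀ᶠ t : ℝ in 𝓝 0, |t| * (2 * ‖y‖) < c / 2 := by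
    have h3 : Tendsto (fun t : ℝ => |t| * (2 * ‖y‖)) (𝓝 0) (𝓝 (|0| * (2 * ‖y‖))) :=
      (Continuous.tendsto (by fun_prop) 0)
    rw [abs_zero, zero_mul] at h3
    exact h3.eventually (gt_mem_nhds (by positivity))
  filter_upwards [h2] with t ht
  -- Density argument: the O(t) bound applies to the small vector x - Ry, the O(t²) bound to Ry.
  have h4 : phaseErr R t x = phaseErr R t (x - R y) + (phaseErr R t * R) y := by
    rw [map_sub, mul_apply_eq_comp, sub_add_cancel]
  rw [h4, sub_zero, Real.norm_eq_abs]
  rw [dist_eq_norm] at hy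
  have h5 : ‖phaseErr R t (x - R y)‖ ≤ 2 * |t| * (c / 4) :=
    ((phaseErr R t).le_opNorm _).trans (mul_le_mul (h.norm_phaseErr_le t) hy.le (norm_nonneg _)
      (by positivity))
  have h6 : ‖(phaseErr R t * R) y‖ ≤ 2 * t ^ 2 * ‖y‖ :=
    ((phaseErr R t * R).le_opNorm _).trans (mul_le_mul_of_nonneg_right (h.norm_phaseErr_mul_le t)
      (norm_nonneg _))
  have h7 : 2 * t ^ 2 * ‖y‖ ≤ |t| * (c / 2) := by
    rw [← sq_abs]
    calc 2 * |t| ^ 2 * ‖y‖ = |t| * (|t| * (2 * ‖y‖)) := by ring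
      _ ≤ _ := by gcongr
  linarith [norm_add_le (phaseErr R t (x - R y)) ((phaseErr R t * R) y)]

theorem mem_graph_iff (x y : E) :
    (x, y) ∈ A.graph ↔ ∃ w, x = R w ∧ y = w + Complex.I • R w := by
  constructor
  · intro hxy
    have h1 : (x, (y - Complex.I • x) + Complex.I • x) ∈ A.graph := by rwa [sub_add_cancel]
    have h2 := h.symm.unique (by simp) h1 (h.mem _)
    exact ⟨y - Complex.I • x, h2, by rw [← h2, sub_add_cancel]⟩
  · rintro ⟨w, rfl, rfl⟩
    exact h.mem w

theorem isUnitaryGroupOf : IsUnitaryGroupOf A (stoneGroup R) where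
  unitary := h.stoneGroup_mem_unitary
  zero := h.stoneGroup_zero
  add := h.stoneGroup_add
  continuous := h.continuous_stoneGroup
  generator x y := by
    constructor
    · intro hxy
      obtain ⟨w, rfl, rfl⟩ := (h.mem_graph_iff x y).1 hxy
      exact h.hasDerivAt_stoneGroup w
    · intro hxy
      -- The generator has no proper symmetric extension: with this w, the vector x - Rw would be an
      -- eigenvector of the generator with eigenvalue i, hence vanishes.
      set w := y - Complex.I • x with hw
      have h1 := hxy.sub (h.hasDerivAt_stoneGroup w)
      have h2 : HasDerivAt (fun t => stoneGroup R t (x - R w))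
          (-(Complex.I • (Complex.I • (x - R w)))) 0 := by
        refine (h1.congr_deriv ?_).congr_of_eventuallyEq (Eventually.of_forall fun t => ?_)
        · rw [hw]; module
        · simp
      have h3 := inner_generator_comm h.stoneGroup_mem_unitary h.stoneGroup_zero h2 h2
      rw [inner_smul_left, inner_smul_right, Complex.conj_I] at h3
      have h4 : inner ℂ (x - R w) (x - R w) = 0 := by
        have h5 : (2 * Complex.I) * inner ℂ (x - R w) (x - R w) = 0 := by linear_combination -h3
        exact (mul_eq_zero.1 h5).resolve_left (by simp)
      have h6 : x = R w := sub_eq_zero.1 (inner_self_eq_zero.1 h4)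
      exact (h.mem_graph_iff x y).2 ⟨w, h6, by rw [← h6, hw, sub_add_cancel]⟩

end IsResolventI

/-- **Stone's theorem**: a symmetric operator with `A ± i` onto generates a unitary group. -/
theorem exists_isUnitaryGroupOf (hA : IsSymmetricOp A) (h1 : IsOntoAt A Complex.I)
    (h2 : IsOntoAt A (-Complex.I)) : ∃ U, IsUnitaryGroupOf A U :=
  let ⟨_, hR⟩ := exists_isResolventI hA h1 h2
  ⟨_, hR.isUnitaryGroupOf⟩

end

/-! ## Existence of the spectral measure -/

section

variable {E : Type*} [NormedAddCommGroup E] [InnerProductSpace ℂ E] [CompleteSpace E]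
variable {A : E →ₗ.[ℂ] E} {R : E →L[ℂ] E}

/-- The quadratic form `⟨ψ, f(R) ψ⟩` as a functional of `f`. -/
def calculusForm (hR : IsStarNormal R) (ψ : E) : C(spectrum ℂ R, ℂ) →ₗ[ℂ] ℂ where
  toFun f := inner ℂ ψ (cfcHom hR f ψ)
  map_add' f g := by rw [map_add, add_apply, inner_add_right]
  map_smul' c f := by rw [map_smul, smul_apply, inner_smul_right]; rfl

/-- A real function as a complex function. -/
def complexify {X : Type*} [TopologicalSpace X] (f : C(X, ℝ)) : C(X, ℂ) :=
  ⟨fun x => (f x : ℂ), Complex.continuous_ofReal.comp f.continuous⟩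

theorem calculusForm_star_mul (hR : IsStarNormal R) (ψ : E) (g : C(spectrum ℂ R, ℂ)) :
    calculusForm hR ψ (star g * g) = ((‖cfcHom hR g ψ‖ ^ 2 : ℝ) : ℂ) := by
  change inner ℂ ψ (cfcHom hR (star g * g) ψ) = _
  rw [map_mul, map_star, mul_apply_eq_comp, ContinuousLinearMap.star_eq_adjoint,
    ContinuousLinearMap.adjoint_inner_right, inner_self_eq_norm_sq_to_K]
  norm_cast

/-- Writing f = g² with g = √f gives ⟨ψ, f(R)ψ⟩ = ‖g(R)ψ‖². -/
theorem calculusForm_nonneg (hR : IsStarNormal R) (ψ : E) {f : C(spectrum ℂ R, ℝ)} (hf : 0 ≤ f) :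
    ∃ s : ℝ, 0 ≤ s ∧ calculusForm hR ψ (complexify f) = s := by
  set g : C(spectrum ℂ R, ℝ) := ⟨fun x => √(f x), f.continuous.sqrt⟩
  have h : complexify f = star (complexify g) * complexify g := by
    ext x
    have h1 : f x = √(f x) * √(f x) := (Real.mul_self_sqrt (hf x)).symm
    change (f x : ℂ) = star ((√(f x) : ℝ) : ℂ) * ((√(f x) : ℝ) : ℂ)
    rw [RCLike.star_def, Complex.conj_ofReal, ← Complex.ofReal_mul, ← h1]
  rw [h, calculusForm_star_mul]
  exact ⟨_, by positivity, rfl⟩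

theorem calculusForm_real (hR : IsStarNormal R) (ψ : E) (f : C(spectrum ℂ R, ℝ)) :
    calculusForm hR ψ (complexify f) = ((calculusForm hR ψ (complexify f)).re : ℝ) := by
  have h1 : complexify f = complexify (f ⊔ 0) - complexify (-f ⊔ 0) := by
    ext x
    change (f x : ℂ) = ((max (f x) 0 : ℝ) : ℂ) - ((max (-f x) 0 : ℝ) : ℂ)
    rw [← Complex.ofReal_sub, max_zero_sub_max_neg_zero_eq_self]
  obtain ⟨s, -, hs⟩ := calculusForm_nonneg hR ψ (f := f ⊔ 0) le_sup_right
  obtain ⟨t, -, ht⟩ := calculusForm_nonneg hR ψ (f := -f ⊔ 0) le_sup_right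
  rw [h1, map_sub, hs, ht, ← Complex.ofReal_sub, Complex.ofReal_re]

/-- The positive functional to which the Riesz–Markov–Kakutani theorem is applied. -/
def realForm (hR : IsStarNormal R) (ψ : E) :
    CompactlySupportedContinuousMap (spectrum ℂ R) ℝ →ₚ[ℝ] ℝ :=
  PositiveLinearMap.mk₀
    { toFun := fun f => (calculusForm hR ψ (complexify f.toContinuousMap)).re
      map_add' := fun f g => by
        rw [← Complex.add_re, ← map_add]
        congr 2
        ext x
        exact Complex.ofReal_add _ _
      map_smul' := fun c f => by
        rw [RingHom.id_apply, smul_eq_mul, ← Complex.re_ofReal_mul, ← smul_eq_mul (c : ℂ),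
          ← map_smul]
        congr 2
        ext x
        exact Complex.ofReal_mul _ _ }
    fun f hf => by
      obtain ⟨s, hs, h⟩ := calculusForm_nonneg hR ψ (f := f.toContinuousMap) hf
      change 0 ≤ (calculusForm hR ψ (complexify f.toContinuousMap)).re
      rw [h]; exact hs

theorem exists_calculus_measure (hR : IsStarNormal R) (ψ : E) :
    ∃ ν : Measure (spectrum ℂ R), IsFiniteMeasure ν ∧
      ∀ f : C(spectrum ℂ R, ℂ), inner ℂ ψ (cfcHom hR f ψ) = ∫ r, f r ∂ν := by
  have : CompactSpace (spectrum ℂ R) := isCompact_iff_compactSpace.1 (spectrum.isCompact R)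
  refine ⟨RealRMK.rieszMeasure (realForm hR ψ), ?_, fun f => ?_⟩
  · infer_instance
  set ν := RealRMK.rieszMeasure (realForm hR ψ)
  have hreal : ∀ g : C(spectrum ℂ R, ℝ),
      calculusForm hR ψ (complexify g) = ((∫ r, g r ∂ν : ℝ) : ℂ) := fun g => by
    rw [calculusForm_real]
    congr 1
    exact (RealRMK.integral_rieszMeasure (realForm hR ψ)
      (CompactlySupportedContinuousMap.continuousMapEquiv g)).symm
  set g1 : C(spectrum ℂ R, ℝ) := ⟨fun r => (f r).re, Complex.continuous_re.comp f.continuous⟩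
  set g2 : C(spectrum ℂ R, ℝ) := ⟨fun r => (f r).im, Complex.continuous_im.comp f.continuous⟩
  have hf : f = complexify g1 + Complex.I • complexify g2 := by
    ext r
    change f r = ((f r).re : ℂ) + Complex.I * ((f r).im : ℂ)
    rw [mul_comm, Complex.re_add_im]
  have hint : ∀ g : C(spectrum ℂ R, ℂ), Integrable g ν := fun g =>
    g.continuous.integrable_of_hasCompactSupport (HasCompactSupport.of_compactSpace _)
  change calculusForm hR ψ f = _
  conv_lhs => rw [hf]
  rw [map_add, map_smul, hreal, hreal]
  have h1 : ∫ r, f r ∂ν = ∫ r, (complexify g1 r + Complex.I * complexify g2 r) ∂ν := by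
    congr 1; ext r
    exact DFunLike.congr_fun hf r
  have h2 : ∀ g : C(spectrum ℂ R, ℝ), ∫ r, complexify g r ∂ν = ((∫ r, g r ∂ν : ℝ) : ℂ) :=
    fun g => integral_ofReal
  rw [h1, integral_add (hint (complexify g1)) ((hint (complexify g2)).const_mul Complex.I),
    integral_const_mul, h2, h2, smul_eq_mul]

/-- For r = (x - i)⁻¹ the expression is r(x - z), with x real and z not; at r = 0 it is 1. -/
theorem one_add_mul_ne_zero {r z : ℂ} (hr : OnCircle r) (hz : z.im ≠ 0) :
    1 + (Complex.I - z) * r ≠ 0 := by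
  intro h
  rcases eq_or_ne r 0 with rfl | h0
  · simp at h
  have h1 : r⁻¹ = z - Complex.I := inv_eq_of_mul_eq_one_right (by linear_combination -h)
  rw [hr.inv_eq h0] at h1
  have h2 := congrArg Complex.im h1
  simp at h2
  exact hz (by linarith)

namespace IsResolventI

variable (h : IsResolventI A R)
include h

theorem resolventApply_eq_cfc {z : ℂ} (hz : z.im ≠ 0) (ψ : E) :
    resolventApply A z ψ = cfc (fun r => r * (1 + (Complex.I - z) * r)⁻¹) R ψ := by
  have := h.normal
  have hne : ∀ r ∈ spectrum ℂ R, 1 + (Complex.I - z) * r ≠ 0 := fun r hr =>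
    one_add_mul_ne_zero (h.onCircle hr) hz
  have hc : ContinuousOn (fun r => (1 + (Complex.I - z) * r)⁻¹) (spectrum ℂ R) :=
    ContinuousOn.inv₀ (by fun_prop) hne
  set G := cfc (fun r => (1 + (Complex.I - z) * r)⁻¹) R with hG
  have h1 : cfc (fun r => r * (1 + (Complex.I - z) * r)⁻¹) R = R * G := by
    rw [cfc_mul (fun r => r) (fun r => (1 + (Complex.I - z) * r)⁻¹) R (by fun_prop) hc,
      cfc_id' ℂ R]
  have h2 : G + (Complex.I - z) • (R * G) = 1 := by
    have h3 : cfc (fun r => (1 + (Complex.I - z) * r)⁻¹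
        + (Complex.I - z) * (r * (1 + (Complex.I - z) * r)⁻¹)) R = 1 := by
      rw [← cfc_one ℂ R]
      refine cfc_congr fun r hr => ?_
      have := hne r hr
      simp only [Pi.one_apply]
      field_simp
    rw [← h3, cfc_add (a := R) (fun r => (1 + (Complex.I - z) * r)⁻¹)
      (fun r => (Complex.I - z) * (r * (1 + (Complex.I - z) * r)⁻¹)) hc (by fun_prop),
      cfc_const_mul (Complex.I - z) (fun r => r * (1 + (Complex.I - z) * r)⁻¹) R (by fun_prop), h1]
  rw [h1]
  refine resolventApply_eq h.symm hz ?_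
  have h4 := h.mem (G ψ)
  have h5 : ψ = G ψ + (Complex.I - z) • R (G ψ) := by
    have h6 := DFunLike.congr_fun h2 ψ
    exact h6.symm
  rw [mul_apply_eq_comp]
  have h7 : ∀ p q : E, ψ = p + (Complex.I - z) • q → ψ + z • q = p + Complex.I • q := by
    intro p q hpq
    rw [hpq]; module
  rwa [← h7 _ _ h5] at h4

theorem exists_isSpectralMeasure (ψ : E) : ∃ μ, IsSpectralMeasure A ψ μ := by
  obtain ⟨ν, hν, hint⟩ := exists_calculus_measure h.normal ψ
  have hm : Measurable fun r : spectrum ℂ R => ((r : ℂ)⁻¹).re :=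
    Complex.measurable_re.comp (measurable_inv.comp measurable_subtype_coe)
  set S : Set (spectrum ℂ R) := {r | (r : ℂ) ≠ 0} with hS
  have hSm : MeasurableSet S := by
    have : MeasurableSet ({0}ᶜ : Set ℂ) := (measurableSet_singleton 0).compl
    exact measurable_subtype_coe this
  -- The spectral variable is x = Re(1/r). The point r = 0, which corresponds to x = ∞, is discarded
  -- at no cost because the resolvent symbol r/(1 + (i - z)r) vanishes there.
  refine ⟨(ν.restrict S).map fun r : spectrum ℂ R => ((r : ℂ)⁻¹).re, inferInstance, fun z hz => ?_⟩
  have := h.normal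
  have hne : ∀ r ∈ spectrum ℂ R, 1 + (Complex.I - z) * r ≠ 0 := fun r hr =>
    one_add_mul_ne_zero (h.onCircle hr) hz
  have hc : ContinuousOn (fun r => r * (1 + (Complex.I - z) * r)⁻¹) (spectrum ℂ R) :=
    continuousOn_id.mul (ContinuousOn.inv₀ (by fun_prop) hne)
  rw [borelTransform, h.resolventApply_eq_cfc hz, cfc_apply _ R h.normal hc, hint,
    integral_map hm.aemeasurable
      (by
        have : Measurable fun x : ℝ => ((x : ℂ) - z)⁻¹ := by fun_prop
        exact this.aestronglyMeasurable)]
  rw [← setIntegral_eq_integral_of_forall_compl_eq_zero (s := S)]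
  · refine setIntegral_congr_fun hSm fun r hr => ?_
    have h1 := (h.onCircle r.2).inv_eq hr
    have h2 : ((((r : ℂ)⁻¹).re : ℂ) - z) = (r : ℂ)⁻¹ + (Complex.I - z) := by
      linear_combination -h1
    have h3 : (r : ℂ) ≠ 0 := hr
    have h4 := hne r r.2
    change (r : ℂ) * (1 + (Complex.I - z) * r)⁻¹ = ((((r : ℂ)⁻¹).re : ℂ) - z)⁻¹
    rw [h2]
    have h5 : (r : ℂ)⁻¹ + (Complex.I - z) = (1 + (Complex.I - z) * r) * (r : ℂ)⁻¹ := by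
      field_simp
    rw [h5, mul_inv, inv_inv, mul_comm]
  · intro r hr
    have h1 : (r : ℂ) = 0 := by simpa [hS] using hr
    change (r : ℂ) * (1 + (Complex.I - z) * r)⁻¹ = 0
    rw [h1, zero_mul]

end IsResolventI

/-- The **spectral theorem** in the form of the existence of spectral measures. -/
theorem exists_isSpectralMeasure (hA : IsSymmetricOp A) (h1 : IsOntoAt A Complex.I)
    (h2 : IsOntoAt A (-Complex.I)) (ψ : E) : ∃ μ, IsSpectralMeasure A ψ μ :=
  let ⟨_, hR⟩ := exists_isResolventI hA h1 h2
  hR.exists_isSpectralMeasure ψ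

end

/-! ## The resolvent as a Laplace transform of the unitary group -/

section

variable {E : Type*} [NormedAddCommGroup E] [InnerProductSpace ℂ E] [CompleteSpace E]
variable {A : E →ₗ.[ℂ] E} {U : ℝ → E →L[ℂ] E}

theorem isUnitaryGroupOf_expNegI (h : ∃ U, IsUnitaryGroupOf A U) :
    IsUnitaryGroupOf A (expNegI A) := by
  rw [expNegI, dif_pos h]; exact h.choose_spec

omit [CompleteSpace E] in
theorem isSpectralMeasure_spectralMeasure {ψ : E} (h : ∃ μ, IsSpectralMeasure A ψ μ) :
    IsSpectralMeasure A ψ (spectralMeasure A ψ) := by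
  rw [spectralMeasure, dif_pos h]; exact h.choose_spec

namespace IsUnitaryGroupOf

theorem norm_apply (hU : IsUnitaryGroupOf A U) (t : ℝ) (x : E) : ‖U t x‖ = ‖x‖ :=
  norm_map_of_mem_unitary (hU.unitary t) x

theorem hasDerivAt (hU : IsUnitaryGroupOf A U) {x y : E} (h : (x, y) ∈ A.graph) (t : ℝ) :
    HasDerivAt (fun s => U s x) (U t (-(Complex.I • y))) t := by
  have h1 : HasDerivAt (fun s => U s x) (-(Complex.I • y)) (t - t) := by
    rw [sub_self]; exact (hU.generator x y).1 h
  have h2 : HasDerivAt (fun s : ℝ => s - t) 1 t := (hasDerivAt_id t).sub_const t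
  have h3 := HasDerivAt.scomp (h := fun s => s - t) t h1 h2
  rw [one_smul] at h3
  have h4 := ((U t).restrictScalars ℝ).hasFDerivAt.comp_hasDerivAt t h3
  refine h4.congr_of_eventuallyEq (Eventually.of_forall fun s => ?_)
  change U s x = U t (U (s - t) x)
  rw [← mul_apply_eq_comp, ← hU.add, add_sub_cancel]

theorem norm_laplace_kernel (hU : IsUnitaryGroupOf A U) (z : ℂ) (η ψ : E) (t : ℝ) :
    ‖Complex.exp (Complex.I * z * t) * inner ℂ η (U t ψ)‖
      ≤ Real.exp (-z.im * t) * (‖η‖ * ‖ψ‖) := by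
  rw [norm_mul, Complex.norm_exp]
  have h1 : (Complex.I * z * t).re = -z.im * t := by simp
  rw [h1]
  gcongr
  rw [← hU.norm_apply t ψ]
  exact norm_inner_le_norm _ _

theorem continuous_laplace_kernel (hU : IsUnitaryGroupOf A U) (z : ℂ) (η ψ : E) :
    Continuous fun t : ℝ => Complex.exp (Complex.I * z * t) * inner ℂ η (U t ψ) := by
  have h1 := hU.continuous ψ
  have h2 : Continuous fun t : ℝ => inner ℂ η (U t ψ) := continuous_const.inner h1
  fun_prop

theorem integrableOn_laplace_kernel (hU : IsUnitaryGroupOf A U) {z : ℂ} (hz : 0 < z.im) (η ψ : E) :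
    IntegrableOn (fun t : ℝ => Complex.exp (Complex.I * z * t) * inner ℂ η (U t ψ))
      (Set.Ioi 0) := by
  have h1 : IntegrableOn (fun t : ℝ => Real.exp (-z.im * t) * (‖η‖ * ‖ψ‖)) (Set.Ioi 0) :=
    (exp_neg_integrableOn_Ioi 0 hz).mul_const _
  exact Integrable.mono' h1 (hU.continuous_laplace_kernel z η ψ).aestronglyMeasurable
    (Eventually.of_forall fun t => hU.norm_laplace_kernel z η ψ t)

/-- The derivative of e^{izt}⟨η, U_t φ⟩ is -i e^{izt}⟨η, U_t(A - z)φ⟩; integrate over t > 0, the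
boundary term at infinity being damped by Im z > 0. -/
theorem inner_resolvent (hU : IsUnitaryGroupOf A U) {z : ℂ} (hz : 0 < z.im) {φ ψ : E}
    (h : (φ, ψ + z • φ) ∈ A.graph) (η : E) :
    inner ℂ η φ
      = Complex.I *
        ∫ t in Set.Ioi (0 : ℝ), Complex.exp (Complex.I * z * t) * inner ℂ η (U t ψ) := by
  have hder : ∀ t : ℝ,
      HasDerivAt (fun t : ℝ => Complex.exp (Complex.I * z * t) * inner ℂ η (U t φ))
        (-Complex.I * (Complex.exp (Complex.I * z * t) * inner ℂ η (U t ψ))) t := by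
    intro t
    have h1 : HasDerivAt (fun t : ℝ => Complex.exp (Complex.I * z * t))
        (Complex.exp (Complex.I * z * t) * (Complex.I * z)) t := by
      have h2 : HasDerivAt (fun t : ℝ => Complex.I * z * (t : ℂ)) (Complex.I * z) t := by
        simpa using (Complex.ofRealCLM.hasDerivAt (x := t)).const_mul (Complex.I * z)
      exact h2.cexp
    have h3 := HasDerivAt.inner ℂ (hasDerivAt_const t η) (hU.hasDerivAt h t)
    refine (h1.mul h3).congr_deriv ?_
    simp only [map_neg, map_smul, map_add, inner_neg_right, inner_smul_right, inner_add_right,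
      inner_zero_left, add_zero]
    ring
  have hlim : Tendsto (fun t : ℝ => Complex.exp (Complex.I * z * t) * inner ℂ η (U t φ)) atTop
      (𝓝 0) := by
    have h1 : Tendsto (fun t : ℝ => Real.exp (-z.im * t) * (‖η‖ * ‖φ‖)) atTop
        (𝓝 (0 * (‖η‖ * ‖φ‖))) := by
      refine Tendsto.mul_const _ (Real.tendsto_exp_atBot.comp ?_)
      exact tendsto_id.const_mul_atTop_of_neg (by linarith)
    rw [zero_mul] at h1
    exact squeeze_zero_norm (hU.norm_laplace_kernel z η φ) h1
  have h4 := integral_Ioi_of_hasDerivAt_of_tendsto (a := 0) (hder 0).continuousAt.continuousWithinAt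
    (fun t _ => hder t) ((hU.integrableOn_laplace_kernel hz η ψ).const_mul (-Complex.I)) hlim
  rw [integral_const_mul] at h4
  simp only [Complex.ofReal_zero, mul_zero, Complex.exp_zero, one_mul, hU.zero,
    one_apply_eq_self, zero_sub] at h4
  linear_combination h4

end IsUnitaryGroupOf

end

/-! ## Self-adjointness of the half-line operator -/

section

variable {a b : ℕ → ℝ}

theorem ext_coe (u : ℕ+ → ℂ) (n : ℕ+) : ext u n = u n := by
  rw [ext, dif_pos n.pos]; rfl

theorem ext_succ (u : ℕ+ → ℂ) (k : ℕ) : ext u (k + 1) = u k.succPNat := by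
  rw [ext, dif_pos k.succ_pos]; rfl

theorem ext_zero (u : ℕ+ → ℂ) : ext u 0 = 0 := by simp [ext]

theorem mem_halfLineOp_graph {u v : HalfLine} :
    (u, v) ∈ (halfLineOp a b).graph ↔ ∀ n, v n = formal a b u n := by
  rw [LinearPMap.mem_graph_iff]
  constructor
  · rintro ⟨y, h1, h2⟩ n
    simp only at h1 h2
    rw [← h2, ← h1]; rfl
  · intro h
    have h1 : (v : ℕ+ → ℂ) = formal a b u := funext h
    have h2 : u ∈ (halfLineOp a b).domain := by
      change Memℓp (formal a b u) 2
      rw [← h1]; exact lp.memℓp v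
    exact ⟨⟨u, h2⟩, rfl, Subtype.ext h1.symm⟩

theorem summable_ext_sq (u : HalfLine) : Summable fun n => ‖ext u n‖ ^ 2 := by
  rw [← summable_nat_add_iff 1]
  have h1 : Summable fun n : ℕ+ => ‖u n‖ ^ 2 := by
    have h2 := (lp.memℓp u).summable (by norm_num)
    simpa using h2
  have h3 := (Equiv.pnatEquivNat.symm.summable_iff (f := fun n : ℕ+ => ‖u n‖ ^ 2)).2 h1
  refine h3.congr fun k => ?_
  rw [ext_succ]; rfl

theorem norm_sq_eq_tsum_ext (u : HalfLine) : ‖u‖ ^ 2 = ∑' k, ‖ext u (k + 1)‖ ^ 2 := by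
  have h1 := lp.norm_rpow_eq_tsum (p := 2) (by norm_num) u
  simp only [ENNReal.toReal_ofNat, Real.rpow_ofNat] at h1
  rw [h1, ← Equiv.pnatEquivNat.symm.tsum_eq]
  refine tsum_congr fun k => ?_
  rw [ext_succ]; rfl

theorem tendsto_sum_inner (u v : HalfLine) :
    Tendsto (fun N => ∑ k ∈ Finset.range N, star (ext u (k + 1)) * ext v (k + 1)) atTop
      (𝓝 (inner ℂ u v)) := by
  have h1 := lp.hasSum_inner (𝕜 := ℂ) u v
  have h2 := (Equiv.pnatEquivNat.symm.hasSum_iff (f := fun n : ℕ+ => inner ℂ (u n) (v n))).2 h1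
  refine h2.tendsto_sum_nat.congr fun N => Finset.sum_congr rfl fun k _ => ?_
  rw [ext_succ, ext_succ, mul_comm]; rfl

/-- The Wronskian boundary term at `N`. -/
def boundaryTerm (a : ℕ → ℝ) (u v : ℕ → ℂ) (N : ℕ) : ℂ :=
  a N * (star (u (N + 1)) * v N - star (u N) * v (N + 1))

theorem sum_formal_sub (u v : ℕ+ → ℂ) (N : ℕ) :
    (∑ k ∈ Finset.range N, star (formal a b u k.succPNat) * ext v (k + 1))
      - (∑ k ∈ Finset.range N, star (ext u (k + 1)) * formal a b v k.succPNat)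
      = boundaryTerm a (ext u) (ext v) N := by
  induction N with
  | zero => simp [boundaryTerm, ext_zero]
  | succ N ih =>
    rw [Finset.sum_range_succ, Finset.sum_range_succ, add_sub_add_comm, ih]
    simp only [boundaryTerm, formal, Nat.succPNat_coe, Nat.succ_eq_add_one, Nat.add_sub_cancel,
      star_add, star_mul', RCLike.star_def, Complex.conj_ofReal]
    ring

/-- The boundary terms of Green's formula converge to the defect. Were it nonzero, 1/|a(N)| would
eventually be dominated by a multiple of the squares of neighbouring entries of two ℓ² vectors, and
so would be summable. -/
theorem isSymmetricOp_halfLineOp (hsum : ¬ Summable fun n : ℕ => |a (n + 1)|⁻¹) :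
    IsSymmetricOp (halfLineOp a b) := by
  intro x y x' y' h h'
  rw [mem_halfLineOp_graph] at h h'
  by_contra hne
  have h1 : Tendsto (fun N => boundaryTerm a (ext x) (ext x') N) atTop
      (𝓝 (inner ℂ y x' - inner ℂ x y')) := by
    refine ((tendsto_sum_inner y x').sub (tendsto_sum_inner x y')).congr fun N => ?_
    rw [← sum_formal_sub (a := a) (b := b)]
    simp only [ext_succ, h, h']
  set c := ‖inner ℂ y x' - inner ℂ x y'‖ / 2 with hc
  have hpos : 0 < ‖inner ℂ y x' - inner ℂ x y'‖ := norm_pos_iff.2 (sub_ne_zero.2 hne)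
  have h2 : ∀ᶠ N in atTop, c < ‖boundaryTerm a (ext x) (ext x') N‖ :=
    h1.norm.eventually (lt_mem_nhds (by rw [hc]; linarith))
  have hc0 : 0 < c := by rw [hc]; linarith
  apply hsum
  rw [summable_nat_add_iff 1 (f := fun n => |a n|⁻¹)]
  have h3 : Summable fun N => c⁻¹ * ((‖ext x (N + 1)‖ ^ 2 + ‖ext x' N‖ ^ 2)
      + (‖ext x N‖ ^ 2 + ‖ext x' (N + 1)‖ ^ 2)) := by
    have e1 := summable_ext_sq x
    have e2 := summable_ext_sq x'
    have e3 := (summable_nat_add_iff 1).2 e1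
    have e4 := (summable_nat_add_iff 1).2 e2
    exact ((e3.add e2).add (e1.add e4)).mul_left _
  refine Summable.of_norm_bounded_eventually_nat h3 ?_
  filter_upwards [h2] with N hN
  have h4 : ‖boundaryTerm a (ext x) (ext x') N‖ ≤ |a N| * ((‖ext x (N + 1)‖ ^ 2 + ‖ext x' N‖ ^ 2)
      + (‖ext x N‖ ^ 2 + ‖ext x' (N + 1)‖ ^ 2)) := by
    rw [boundaryTerm, norm_mul, Complex.norm_real, Real.norm_eq_abs]
    refine mul_le_mul_of_nonneg_left ((norm_sub_le _ _).trans ?_) (abs_nonneg _)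
    rw [norm_mul, norm_mul, norm_star, norm_star]
    nlinarith [sq_nonneg (‖ext x (N + 1)‖ - ‖ext x' N‖), sq_nonneg (‖ext x N‖ - ‖ext x' (N + 1)‖),
      sq_nonneg (‖ext x (N + 1)‖ + ‖ext x' N‖), sq_nonneg (‖ext x N‖ + ‖ext x' (N + 1)‖)]
  have ha : 0 < |a N| := by
    by_contra! h5
    have h6 : |a N| = 0 := le_antisymm h5 (abs_nonneg _)
    rw [h6, zero_mul] at h4
    linarith
  rw [Real.norm_eq_abs, abs_inv, abs_abs, inv_le_iff_one_le_mul₀ ha, ← div_eq_inv_mul,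
    div_mul_eq_mul_div, one_le_div hc0, mul_comm]
  exact hN.le.trans h4

/-- The basis vector at `m`, which is zero for `m = 0`. -/
def site (m : ℕ) : HalfLine := if h : 0 < m then lp.single 2 (m.toPNat h) (1 : ℂ) else 0

theorem site_one : site 1 = delta1 := rfl

theorem inner_site (m : ℕ) (u : HalfLine) : inner ℂ (site m) u = ext u m := by
  unfold site ext
  split
  · rw [lp.inner_single_left]; simp
  · simp

theorem ext_site (m k : ℕ) : ext (site m) k = if k = m ∧ 0 < m then 1 else 0 := by
  unfold site ext
  by_cases hk : 0 < k
  · rw [dif_pos hk]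
    by_cases hm : 0 < m
    · rw [dif_pos hm, lp.coeFn_single, Pi.single_apply]
      have h1 : k.toPNat hk = m.toPNat hm ↔ k = m := by
        rw [← PNat.coe_inj]; rfl
      simp [h1, hm]
    · rw [dif_neg hm]; simp [hm]
  · rw [dif_neg hk, if_neg (by omega)]

theorem site_mem_graph (n : ℕ+) : (site n, (a n : ℂ) • site (n + 1)
    + (a (n - 1) : ℂ) • site (n - 1) + (b n : ℂ) • site n) ∈ (halfLineOp a b).graph := by
  rw [mem_halfLineOp_graph]
  intro k
  refine (ext_coe _ k).symm.trans ?_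
  rw [lp.coeFn_add, ext_add, lp.coeFn_add, ext_add, lp.coeFn_smul, ext_smul,
    lp.coeFn_smul, ext_smul, lp.coeFn_smul, ext_smul, formal]
  simp only [ext_site]
  have hk := k.pos
  have hn := n.pos
  generalize (k : ℕ) = k at *
  generalize (n : ℕ) = n at *
  rcases lt_trichotomy k n with h | rfl | h
  · by_cases h2 : k + 1 = n
    · subst h2
      simp [hk, show k ≠ k + 1 + 1 by omega, show k - 1 ≠ k + 1 by omega]
    · simp [show k ≠ n by omega, show k ≠ n + 1 by omega, h2, show k ≠ n - 1 by omega,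
        show k - 1 ≠ n by omega]
  · simp [hk, show k ≠ k - 1 by omega, show k - 1 ≠ k by omega]
  · by_cases h2 : k = n + 1
    · subst h2
      simp [hn, show n + 1 ≠ n - 1 by omega, show n + 1 + 1 ≠ n by omega]
    · simp [show k ≠ n by omega, show k ≠ n - 1 by omega, h2, show k + 1 ≠ n by omega,
        show k - 1 ≠ n by omega]

theorem isClosed_graph_halfLineOp :
    IsClosed ((halfLineOp a b).graph : Set (HalfLine × HalfLine)) := by
  have h1 : ((halfLineOp a b).graph : Set (HalfLine × HalfLine))
      = ⋂ n : ℕ+, {p | p.2 n = formal a b p.1 n} := by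
    ext ⟨u, v⟩
    simp only [SetLike.mem_coe, mem_halfLineOp_graph, Set.mem_iInter, Set.mem_ofPred_eq]
  have h2 : ∀ n : ℕ, Continuous fun u : HalfLine => ext u n := fun n => by
    simp only [← inner_site]
    fun_prop
  rw [h1]
  refine isClosed_iInter fun n => isClosed_eq ?_ ?_
  · have h3 := (h2 n).comp (continuous_snd (X := HalfLine) (Y := HalfLine))
    refine h3.congr fun p => ?_
    exact ext_coe _ n
  · have e1 := (h2 (n + 1)).comp (continuous_fst (X := HalfLine) (Y := HalfLine))
    have e2 := (h2 (n - 1)).comp (continuous_fst (X := HalfLine) (Y := HalfLine))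
    have e3 := (h2 n).comp (continuous_fst (X := HalfLine) (Y := HalfLine))
    exact ((continuous_const.mul e1).add (continuous_const.mul e2)).add (continuous_const.mul e3)

/-- The range of A - w is closed by the bound |Im w|‖φ‖ ≤ ‖(A - w)φ‖ and closedness of the graph. A
vector orthogonal to it solves the difference equation at w̄, as testing on basis vectors shows; it
belongs to the maximal domain and is zero by symmetry. -/
theorem isOntoAt_halfLineOp (hsum : ¬ Summable fun n : ℕ => |a (n + 1)|⁻¹) {w : ℂ}
    (hw : w.im ≠ 0) : IsOntoAt (halfLineOp a b) w := by
  have hA := isSymmetricOp_halfLineOp (b := b) hsum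
  set K : Submodule ℂ HalfLine :=
    (halfLineOp a b).graph.map (LinearMap.snd ℂ HalfLine HalfLine - w • LinearMap.fst ℂ _ _) with hK
  have hmem : ∀ ψ, ψ ∈ K ↔ ∃ φ, (φ, ψ + w • φ) ∈ (halfLineOp a b).graph := by
    intro ψ
    rw [hK, Submodule.mem_map]
    constructor
    · rintro ⟨⟨u, v⟩, h1, rfl⟩
      refine ⟨u, ?_⟩
      simpa using h1
    · rintro ⟨φ, h1⟩
      exact ⟨_, h1, by simp⟩
  have hclosed : IsClosed (K : Set HalfLine) := by
    rw [← isSeqClosed_iff_isClosed]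
    intro ψ ψ₀ hψ hlim
    choose φ hφ using fun n => (hmem _).1 (hψ n)
    have h1 : ∀ n m, |w.im| * dist (φ n) (φ m) ≤ dist (ψ n) (ψ m) := fun n m => by
      rw [dist_eq_norm, dist_eq_norm]
      exact hA.norm_le (graph_sub (hφ n) (hφ m))
    have h2 : CauchySeq φ := by
      rw [Metric.cauchySeq_iff]
      intro ε hε
      obtain ⟨N, hN⟩ := Metric.cauchySeq_iff.1 hlim.cauchySeq (|w.im| * ε)
        (mul_pos (abs_pos.2 hw) hε)
      exact ⟨N, fun m hm n hn =>
        lt_of_mul_lt_mul_left ((h1 m n).trans_lt (hN m hm n hn)) (abs_nonneg _)⟩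
    obtain ⟨φ₀, hφ₀⟩ := cauchySeq_tendsto_of_complete h2
    refine (hmem ψ₀).2 ⟨φ₀, ?_⟩
    exact isClosed_graph_halfLineOp.mem_of_tendsto
      (hφ₀.prodMk_nhds (hlim.add (hφ₀.const_smul w))) (Eventually.of_forall hφ)
  have htop : K = ⊤ := by
    have : CompleteSpace K := hclosed.completeSpace_coe
    rw [← Submodule.orthogonal_eq_bot_iff, Submodule.eq_bot_iff]
    intro η hη
    have h1 : (η, 0 + (starRingEnd ℂ w) • η) ∈ (halfLineOp a b).graph := by
      rw [mem_halfLineOp_graph]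
      intro n
      have h2 := (Submodule.mem_orthogonal _ _).1 hη _
        ((hmem _).2 ⟨site n, by rw [sub_add_cancel]; exact site_mem_graph n⟩)
      rw [inner_sub_left, inner_add_left, inner_add_left, inner_smul_left, inner_smul_left,
        inner_smul_left, inner_smul_left, inner_site, inner_site, inner_site, Complex.conj_ofReal,
        Complex.conj_ofReal, Complex.conj_ofReal] at h2
      rw [zero_add, lp.coeFn_smul, Pi.smul_apply, smul_eq_mul, formal, ← ext_coe (η : ℕ+ → ℂ) n]
      linear_combination -h2
    have h3 : ((0 : HalfLine), 0 + (starRingEnd ℂ w) • (0 : HalfLine))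
        ∈ (halfLineOp a b).graph := by
      rw [smul_zero, add_zero]; exact (halfLineOp a b).graph.zero_mem
    exact hA.unique (by simpa using hw) h1 h3
  intro ψ
  exact (hmem ψ).1 (by rw [htop]; trivial)

end

/-! ## Transfer matrices -/

theorem opNorm_nonneg (M : Matrix (Fin 2) (Fin 2) ℝ) : 0 ≤ opNorm M := norm_nonneg _

theorem sum_sq_mulVec_le (M : Matrix (Fin 2) (Fin 2) ℝ) (v : Fin 2 → ℝ) :
    ∑ i, (M.mulVec v) i ^ 2 ≤ opNorm M ^ 2 * ∑ i, v i ^ 2 := by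
  have h := (Matrix.toEuclideanCLM (𝕜 := ℝ) M).le_opNorm (WithLp.toLp 2 v)
  have h2 := pow_le_pow_left₀ (norm_nonneg _) h 2
  rw [mul_pow, EuclideanSpace.norm_sq_eq, EuclideanSpace.norm_sq_eq] at h2
  simpa [opNorm] using h2

theorem opNorm_sq_le {M : Matrix (Fin 2) (Fin 2) ℝ} {c : ℝ} (hc : 0 ≤ c)
    (h : ∀ v : Fin 2 → ℝ, ∑ i, (M.mulVec v) i ^ 2 ≤ c * ∑ i, v i ^ 2) : opNorm M ^ 2 ≤ c := by
  have h1 : opNorm M ≤ √c := by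
    refine ContinuousLinearMap.opNorm_le_bound _ (Real.sqrt_nonneg c) fun x => ?_
    refine abs_le_of_sq_le_sq' ?_ (by positivity) |>.2
    rw [mul_pow, Real.sq_sqrt hc, EuclideanSpace.norm_sq_eq, EuclideanSpace.norm_sq_eq]
    simpa using h x.ofLp
  calc opNorm M ^ 2 ≤ √c ^ 2 := pow_le_pow_left₀ (opNorm_nonneg M) h1 2
    _ = c := Real.sq_sqrt hc

theorem sum_sq_le_opNorm_inv {M : Matrix (Fin 2) (Fin 2) ℝ} (hM : M.det ≠ 0) (v : Fin 2 → ℝ) :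
    ∑ i, v i ^ 2 ≤ opNorm M⁻¹ ^ 2 * ∑ i, (M.mulVec v) i ^ 2 := by
  have h := sum_sq_mulVec_le M⁻¹ (M.mulVec v)
  rwa [Matrix.mulVec_mulVec, Matrix.nonsing_inv_mul M (isUnit_iff_ne_zero.2 hM),
    Matrix.one_mulVec] at h

theorem opNorm_inv_pos {M : Matrix (Fin 2) (Fin 2) ℝ} (hM : M.det ≠ 0) : 0 < opNorm M⁻¹ := by
  refine lt_of_le_of_ne (opNorm_nonneg _) fun h => ?_
  have h1 := sum_sq_le_opNorm_inv hM ![1, 0]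
  rw [← h] at h1
  simp at h1
  linarith

theorem row_sq_le (M : Matrix (Fin 2) (Fin 2) ℝ) : M 0 0 ^ 2 + M 0 1 ^ 2 ≤ opNorm M ^ 2 := by
  have h := sum_sq_mulVec_le M ![M 0 0, M 0 1]
  simp only [Fin.sum_univ_two, Matrix.mulVec, dotProduct, Matrix.cons_val_zero,
    Matrix.cons_val_one] at h
  set s := M 0 0 ^ 2 + M 0 1 ^ 2 with hs
  have h1 : s * s ≤ opNorm M ^ 2 * s := by
    refine le_trans ?_ h
    rw [hs]
    nlinarith [sq_nonneg (M 1 0 * M 0 0 + M 1 1 * M 0 1)]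
  rcases (show 0 ≤ s by positivity).eq_or_lt with h0 | h0
  · rw [← h0]; positivity
  · exact le_of_mul_le_mul_right h1 h0

/-- Both columns have norm at most ‖M‖, and the determinant is at most the product of the column
norms. -/
theorem abs_det_le (M : Matrix (Fin 2) (Fin 2) ℝ) : |M.det| ≤ opNorm M ^ 2 := by
  have h1 := sum_sq_mulVec_le M ![1, 0]
  have h2 := sum_sq_mulVec_le M ![0, 1]
  simp only [Fin.sum_univ_two, Matrix.mulVec, dotProduct, Matrix.cons_val_zero,
    Matrix.cons_val_one] at h1 h2
  rw [Matrix.det_fin_two, abs_le]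
  constructor <;> nlinarith [sq_nonneg (M 0 0 + M 1 1), sq_nonneg (M 0 1 - M 1 0),
    sq_nonneg (M 0 0 - M 1 1), sq_nonneg (M 0 1 + M 1 0)]

section

variable {a b : ℕ → ℝ}

theorem wronskian (ha : ∀ n, a n ≠ 0) (ha0 : a 0 = 1) (E : ℝ) (n : ℕ) :
    a n * (uSol a b 0 E (n + 1) * uSol a b (Real.pi / 2) E n
      - uSol a b (Real.pi / 2) E (n + 1) * uSol a b 0 E n) = 1 := by
  induction n with
  | zero => simp [uSol, ha0]
  | succ n ih =>
    have h1 := uSol_eq a b ha 0 E (n + 1) (by omega)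
    have h2 := uSol_eq a b ha (Real.pi / 2) E (n + 1) (by omega)
    rw [Nat.add_sub_cancel] at h1 h2
    linear_combination ih + uSol a b (Real.pi / 2) E (n + 1) * h1 - uSol a b 0 E (n + 1) * h2

theorem det_transfer (ha : ∀ n, a n ≠ 0) (ha0 : a 0 = 1) (E : ℝ) (n : ℕ) :
    (transfer a b n E).det = (a n)⁻¹ := by
  rw [transfer, Matrix.det_fin_two_of]
  exact eq_inv_of_mul_eq_one_right (wronskian ha ha0 E n)

theorem inv_abs_le_opNorm_transfer_sq (ha : ∀ n, a n ≠ 0) (ha0 : a 0 = 1) (E : ℝ) (n : ℕ) :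
    |a n|⁻¹ ≤ opNorm (transfer a b n E) ^ 2 := by
  rw [← abs_inv, ← det_transfer (b := b) ha ha0 E n]
  exact abs_det_le _

theorem opNorm_transfer_sq_pos (ha : ∀ n, a n ≠ 0) (ha0 : a 0 = 1) (E : ℝ) (n : ℕ) :
    0 < opNorm (transfer a b n E) ^ 2 :=
  (inv_pos.2 (abs_pos.2 (ha n))).trans_le (inv_abs_le_opNorm_transfer_sq ha ha0 E n)

/-- The square of `transferNorm`. -/
def transferSq (a b : ℕ → ℝ) (E L : ℝ) : ℝ :=
  ∑ n ∈ Finset.Icc 1 (⌊L⌋₊ - 1), opNorm (transfer a b n E) ^ 2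
    + (L - ⌊L⌋₊) * opNorm (transfer a b ⌊L⌋₊ E) ^ 2

theorem transferSq_nonneg (E : ℝ) {L : ℝ} (hL : 1 ≤ L) : 0 ≤ transferSq a b E L := by
  have h1 : 0 ≤ L - ⌊L⌋₊ := sub_nonneg.2 (Nat.floor_le (by linarith))
  unfold transferSq
  positivity

theorem transferNorm_sq (E : ℝ) {L : ℝ} (hL : 1 ≤ L) :
    transferNorm a b E L ^ 2 = transferSq a b E L :=
  Real.sq_sqrt (transferSq_nonneg E hL)

theorem transferSq_strictMono (ha : ∀ n, a n ≠ 0) (ha0 : a 0 = 1) (E : ℝ) {L L' : ℝ} (hL : 1 ≤ L)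
    (h : L < L') : transferSq a b E L < transferSq a b E L' := by
  have hpos := opNorm_transfer_sq_pos (b := b) ha ha0 E
  have h1 : ⌊L⌋₊ ≤ ⌊L'⌋₊ := Nat.floor_le_floor h.le
  have hN : 1 ≤ ⌊L⌋₊ := Nat.le_floor (by simpa using hL)
  rcases h1.eq_or_lt with h2 | h2
  · unfold transferSq
    rw [h2]
    have := hpos ⌊L'⌋₊
    gcongr
  · have h3 : transferSq a b E L < ∑ n ∈ Finset.Icc 1 ⌊L⌋₊, opNorm (transfer a b n E) ^ 2 := by
      obtain ⟨k, hk⟩ : ∃ k, ⌊L⌋₊ = k + 1 := ⟨⌊L⌋₊ - 1, by omega⟩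
      have h4 := Nat.lt_floor_add_one L
      unfold transferSq
      rw [hk] at h4 ⊢
      rw [Finset.sum_Icc_succ_top (by omega), Nat.add_sub_cancel]
      have := hpos (k + 1)
      have h5 : L - ((k + 1 : ℕ) : ℝ) < 1 := by linarith
      have h6 := mul_lt_mul_of_pos_right h5 this
      linarith
    refine h3.trans_le ?_
    have h4 : 0 ≤ (L' - ⌊L'⌋₊) * opNorm (transfer a b ⌊L'⌋₊ E) ^ 2 :=
      mul_nonneg (sub_nonneg.2 (Nat.floor_le (by linarith))) (hpos _).le
    have h5 : ∑ n ∈ Finset.Icc 1 ⌊L⌋₊, opNorm (transfer a b n E) ^ 2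
        ≤ ∑ n ∈ Finset.Icc 1 (⌊L'⌋₊ - 1), opNorm (transfer a b n E) ^ 2 :=
      Finset.sum_le_sum_of_subset_of_nonneg (Finset.Icc_subset_Icc_right (by omega))
        fun n _ _ => (hpos n).le
    unfold transferSq
    linarith

theorem exists_transferSq_eq (ha : ∀ n, a n ≠ 0) (ha0 : a 0 = 1)
    (hsum : ¬ Summable fun n : ℕ => |a (n + 1)|⁻¹) (E : ℝ) {c : ℝ} (hc : 0 ≤ c) :
    ∃ L, 1 ≤ L ∧ transferSq a b E L = c := by
  have hpos := opNorm_transfer_sq_pos (b := b) ha ha0 E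
  -- The terms are at least |det Φ(n)| = 1/|a(n)|, so their sum diverges.
  have hex : ∃ N, c < ∑ n ∈ Finset.Icc 1 N, opNorm (transfer a b n E) ^ 2 := by
    by_contra! hle
    refine hsum (summable_of_sum_range_le (c := c) (fun n => by positivity) fun N => ?_)
    refine le_trans ?_ (hle N)
    rw [Finset.range_eq_Ico, Finset.sum_Ico_add' (fun n => |a n|⁻¹) 0 N 1]
    exact Finset.sum_le_sum fun n _ => inv_abs_le_opNorm_transfer_sq ha ha0 E n
  have h1 := Nat.find_spec hex
  have h2 := fun m => Nat.find_min hex (m := m)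
  generalize Nat.find hex = N at h1 h2
  obtain ⟨k, rfl⟩ : ∃ k, N = k + 1 := by
    refine ⟨N - 1, ?_⟩
    rcases N.eq_zero_or_pos with rfl | h
    · simp at h1; linarith
    · omega
  have h3 := not_lt.1 (h2 k (by omega))
  rw [Finset.sum_Icc_succ_top (by omega)] at h1
  set P := ∑ n ∈ Finset.Icc 1 k, opNorm (transfer a b n E) ^ 2
  have hp := hpos (k + 1)
  have ht0 : 0 ≤ (c - P) / opNorm (transfer a b (k + 1) E) ^ 2 :=
    div_nonneg (by linarith) hp.le
  have ht1 : (c - P) / opNorm (transfer a b (k + 1) E) ^ 2 < 1 := by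
    rw [div_lt_one hp]; linarith
  have hfl : ⌊((k + 1 : ℕ) : ℝ) + (c - P) / opNorm (transfer a b (k + 1) E) ^ 2⌋₊ = k + 1 := by
    rw [Nat.floor_eq_iff (by positivity)]
    constructor <;> linarith
  -- Here k + 1 is the first index at which the partial sum exceeds c; between k + 1 and k + 2 the
  -- squared norm is affine in L, starting from P.
  refine ⟨((k + 1 : ℕ) : ℝ) + (c - P) / opNorm (transfer a b (k + 1) E) ^ 2, ?_, ?_⟩
  · push_cast
    have : (0 : ℝ) ≤ k := by positivity
    linarith
  · rw [transferSq, hfl, add_sub_cancel_left, div_mul_cancel₀ _ hp.ne', Nat.add_sub_cancel]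
    ring

/-- The length scale `scaleTilde` is a solution of its defining equation. -/
theorem scaleTilde_spec (ha : ∀ n, a n ≠ 0) (ha0 : a 0 = 1)
    (hsum : ¬ Summable fun n : ℕ => |a (n + 1)|⁻¹) (E : ℝ) {ε : ℝ} (hε : 0 < ε) :
    1 ≤ scaleTilde a b ε E ∧ transferNorm a b E (scaleTilde a b ε E)
      = 2 * opNorm (transfer a b 1 E)⁻¹ * ε⁻¹ := by
  set c := 2 * opNorm (transfer a b 1 E)⁻¹ * ε⁻¹ with hc
  have hc0 : 0 ≤ c := by have := opNorm_nonneg (transfer a b 1 E)⁻¹; positivity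
  have hiff : ∀ L, 1 ≤ L → (transferNorm a b E L = c ↔ transferSq a b E L = c ^ 2) := fun L hL => by
    rw [← transferNorm_sq E hL]
    exact (pow_left_inj₀ (Real.sqrt_nonneg _) hc0 (by norm_num)).symm
  obtain ⟨L, hL, hLc⟩ := exists_transferSq_eq (b := b) ha ha0 hsum E (sq_nonneg c)
  have hset : {L : ℝ | 1 ≤ L ∧ transferNorm a b E L = c} = {L} := by
    ext L'
    constructor
    · rintro ⟨h1, h2⟩
      rw [hiff L' h1] at h2
      rcases lt_trichotomy L' L with h | h | h
      · have := transferSq_strictMono (b := b) ha ha0 E h1 h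
        linarith
      · exact h
      · have := transferSq_strictMono (b := b) ha ha0 E hL h
        linarith
    · rintro rfl
      exact ⟨hL, (hiff _ hL).2 hLc⟩
  have h1 : scaleTilde a b ε E = L := by
    rw [scaleTilde, ← hc, hset, csInf_singleton]
  rw [h1]
  exact ⟨hL, (hiff L hL).2 hLc⟩

end

/-! ## Solutions at complex energy compared with transfer matrices at real energy -/

section

variable {a b : ℕ → ℝ}

/-- The coordinates of the solution `u` at site `n` in the basis of real solutions at energy `E`. -/
def coords (a b : ℕ → ℝ) (E : ℝ) (u : ℕ → ℂ) (n : ℕ) : EuclideanSpace ℂ (Fin 2) :=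
  !₂[(a n : ℂ) * (uSol a b (Real.pi / 2) E n * u (n + 1) - uSol a b (Real.pi / 2) E (n + 1) * u n),
    (a n : ℂ) * (uSol a b 0 E (n + 1) * u n - uSol a b 0 E n * u (n + 1))]

theorem norm_sq_fin_two (x y : ℂ) :
    ‖(!₂[x, y] : EuclideanSpace ℂ (Fin 2))‖ ^ 2 = ‖x‖ ^ 2 + ‖y‖ ^ 2 := by
  rw [EuclideanSpace.norm_sq_eq, Fin.sum_univ_two]; rfl

theorem wronskian_complex (ha : ∀ n, a n ≠ 0) (ha0 : a 0 = 1) (E : ℝ) (n : ℕ) :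
    (a n : ℂ) * ((uSol a b 0 E (n + 1) : ℂ) * uSol a b (Real.pi / 2) E n
      - uSol a b (Real.pi / 2) E (n + 1) * uSol a b 0 E n) = 1 := by
  exact_mod_cast wronskian (b := b) ha ha0 E n

theorem coords_succ_eq (ha : ∀ n, a n ≠ 0) (ha0 : a 0 = 1) (E : ℝ) (u : ℕ → ℂ) (n : ℕ) :
    (uSol a b 0 E (n + 1) : ℂ) * coords a b E u n 0
      + uSol a b (Real.pi / 2) E (n + 1) * coords a b E u n 1 = u (n + 1) := by
  have h := wronskian_complex (b := b) ha ha0 E n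
  simp only [coords, PiLp.toLp_apply, Matrix.cons_val_zero, Matrix.cons_val_one]
  linear_combination u (n + 1) * h

theorem coords_eq (ha : ∀ n, a n ≠ 0) (ha0 : a 0 = 1) (E : ℝ) (u : ℕ → ℂ) (n : ℕ) :
    (uSol a b 0 E n : ℂ) * coords a b E u n 0
      + uSol a b (Real.pi / 2) E n * coords a b E u n 1 = u n := by
  have h := wronskian_complex (b := b) ha ha0 E n
  simp only [coords, PiLp.toLp_apply, Matrix.cons_val_zero, Matrix.cons_val_one]
  linear_combination u n * h

/-- `u` solves the difference equation with spectral parameter `z`. -/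
def IsSolution (a b : ℕ → ℝ) (z : ℂ) (u : ℕ → ℂ) : Prop :=
  ∀ n, (a (n + 1) : ℂ) * u (n + 2) + a n * u n + b (n + 1) * u (n + 1) = z * u (n + 1)

/-- Variation of parameters: the coordinates would be constant if u solved the equation at energy E,
and the inhomogeneity is (z - E)u(n+1). -/
theorem coords_succ_sub (ha : ∀ n, a n ≠ 0) (E : ℝ) {z : ℂ} {u : ℕ → ℂ} (hu : IsSolution a b z u)
    (n : ℕ) : coords a b E u (n + 1) - coords a b E u n = ((z - E) * u (n + 1)) •
      !₂[(uSol a b (Real.pi / 2) E (n + 1) : ℂ), -(uSol a b 0 E (n + 1) : ℂ)] := by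
  have h := hu n
  have h1 : (a (n + 1) : ℂ) * uSol a b 0 E (n + 1 + 1) + a n * uSol a b 0 E n
      + b (n + 1) * uSol a b 0 E (n + 1) = E * uSol a b 0 E (n + 1) := by
    exact_mod_cast uSol_eq a b ha 0 E (n + 1) (by omega)
  have h2 : (a (n + 1) : ℂ) * uSol a b (Real.pi / 2) E (n + 1 + 1)
      + a n * uSol a b (Real.pi / 2) E n
      + b (n + 1) * uSol a b (Real.pi / 2) E (n + 1) = E * uSol a b (Real.pi / 2) E (n + 1) := by
    exact_mod_cast uSol_eq a b ha (Real.pi / 2) E (n + 1) (by omega)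
  ext i
  fin_cases i
  · simp only [coords, PiLp.sub_apply, PiLp.smul_apply, Fin.zero_eta,
      Matrix.cons_val_zero, smul_eq_mul]
    linear_combination uSol a b (Real.pi / 2) E (n + 1) * h - u (n + 1) * h2
  · simp only [coords, PiLp.sub_apply, PiLp.smul_apply, Fin.mk_one,
      Matrix.cons_val_one, Matrix.cons_val_fin_one, smul_eq_mul]
    linear_combination -uSol a b 0 E (n + 1) * h + u (n + 1) * h1

/-- The vector of solutions at site n + 1 is, up to rotation, the top row of Φ(n). Thus reaching
site N involves only Φ(1), …, Φ(N-1), which matches the summation range in `transferNorm`. -/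
theorem norm_coords_succ_sub_le (ha : ∀ n, a n ≠ 0) (E : ℝ) {z : ℂ} {u : ℕ → ℂ}
    (hu : IsSolution a b z u) (n : ℕ) : ‖coords a b E u (n + 1) - coords a b E u n‖
      ≤ ‖z - E‖ * (‖u (n + 1)‖ * opNorm (transfer a b n E)) := by
  rw [coords_succ_sub ha E hu, norm_smul, norm_mul, mul_assoc]
  gcongr
  refine abs_le_of_sq_le_sq' ?_ (opNorm_nonneg _) |>.2
  rw [norm_sq_fin_two, norm_neg, Complex.norm_real, Complex.norm_real, Real.norm_eq_abs,
    Real.norm_eq_abs, sq_abs, sq_abs, add_comm]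
  exact row_sq_le (transfer a b n E)

theorem norm_coords_le (ha : ∀ n, a n ≠ 0) (E : ℝ) {z : ℂ} {u : ℕ → ℂ}
    (hu : IsSolution a b z u) {N : ℕ} (hN : 1 ≤ N) : ‖coords a b E u N‖
      ≤ ‖coords a b E u 1‖ + ‖z - E‖ * √((∑ n ∈ Finset.Icc 1 N, ‖u n‖ ^ 2)
        * ∑ n ∈ Finset.Icc 1 (N - 1), opNorm (transfer a b n E) ^ 2) := by
  obtain ⟨k, rfl⟩ : ∃ k, N = k + 1 := ⟨N - 1, by omega⟩
  rw [Nat.add_sub_cancel]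
  have h1 : ‖coords a b E u (k + 1)‖ ≤ ‖coords a b E u 1‖
      + ∑ n ∈ Finset.Icc 1 k, ‖z - E‖ * (‖u (n + 1)‖ * opNorm (transfer a b n E)) := by
    clear hN
    induction k with
    | zero => simp
    | succ k ih =>
      rw [Finset.sum_Icc_succ_top (by omega)]
      have h2 := norm_coords_succ_sub_le ha E hu (k + 1)
      have h3 := norm_le_norm_add_norm_sub' (coords a b E u (k + 1 + 1)) (coords a b E u (k + 1))
      linarith
  refine h1.trans ?_
  rw [← Finset.mul_sum]
  gcongr
  refine Real.le_sqrt_of_sq_le ?_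
  refine (Finset.sum_mul_sq_le_sq_mul_sq _ _ _).trans ?_
  gcongr
  have h4 : ∑ n ∈ Finset.Icc 1 k, ‖u (n + 1)‖ ^ 2 = ∑ n ∈ Finset.Ioc 1 (k + 1), ‖u n‖ ^ 2 := by
    refine Finset.sum_bij (fun n _ => n + 1) (fun n hn => ?_) (fun _ _ _ _ h => by omega)
      (fun n hn => ⟨n - 1, ?_, ?_⟩) fun _ _ => rfl
    · simp only [Finset.mem_Icc, Finset.mem_Ioc] at hn ⊢; omega
    · simp only [Finset.mem_Icc, Finset.mem_Ioc] at hn ⊢; omega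
    · simp only [Finset.mem_Ioc] at hn; omega
  rw [h4]
  exact Finset.sum_le_sum_of_subset_of_nonneg Finset.Ioc_subset_Icc_self
    fun _ _ _ => by positivity

/-- Multiplying the equation at site n + 1 by the conjugate of u(n+1) and taking imaginary parts
leaves a telescoping identity, because a and b are real. -/
theorem flux_eq {z : ℂ} {u : ℕ → ℂ} (hu : IsSolution a b z u) (ha0 : a 0 = 1) (hu0 : u 0 = -1)
    (n : ℕ) : a n * (u (n + 1) * star (u n)).im
      = -(u 1).im + z.im * ∑ k ∈ Finset.Icc 1 n, ‖u k‖ ^ 2 := by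
  induction n with
  | zero => simp [ha0, hu0]
  | succ n ih =>
    rw [Finset.sum_Icc_succ_top (by omega), mul_add, ← add_assoc, ← ih,
      ← Complex.normSq_eq_norm_sq, Complex.normSq_apply]
    have h1 := congrArg (fun w : ℂ => (w * star (u (n + 1))).im) (hu n)
    simp only [RCLike.star_def, Complex.mul_im, Complex.mul_re, Complex.add_im, Complex.add_re,
      Complex.conj_re, Complex.conj_im, Complex.ofReal_re, Complex.ofReal_im] at h1 ⊢
    linear_combination h1

/-- As Φ(n) is real, it maps (Re c, Im c) to the real and imaginary parts of (u(n+1), u(n)); take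
determinants and use det Φ(n) = 1/a(n). -/
theorem det_coords (ha : ∀ n, a n ≠ 0) (ha0 : a 0 = 1) (E : ℝ) (u : ℕ → ℂ) (n : ℕ) :
    (coords a b E u n 0).re * (coords a b E u n 1).im
      - (coords a b E u n 0).im * (coords a b E u n 1).re
      = -(a n * (u (n + 1) * star (u n)).im) := by
  have h := wronskian (b := b) ha ha0 E n
  simp only [coords, PiLp.toLp_apply, Matrix.cons_val_zero, Matrix.cons_val_one, RCLike.star_def,
    Complex.mul_im, Complex.mul_re, Complex.sub_im, Complex.sub_re,
    Complex.conj_re, Complex.conj_im, Complex.ofReal_re, Complex.ofReal_im]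
  linear_combination (a n * ((u (n + 1)).re * (u n).im - (u (n + 1)).im * (u n).re)) * h

/-- With C the matrix with rows (p₁, q₁) and (p₂, q₂), a row vector c satisfies det(C) c = (cC)
adj(C). Cauchy–Schwarz and the Hilbert–Schmidt norm of adj(C) give the bound. -/
theorem sq_lin_comb_le (x y p₁ q₁ p₂ q₂ c₁ c₂ : ℝ) :
    ((p₁ * q₂ - q₁ * p₂) * (c₁ * x + c₂ * y)) ^ 2
      ≤ ((c₁ * p₁ + c₂ * p₂) ^ 2 + (c₁ * q₁ + c₂ * q₂) ^ 2)
        * ((p₁ ^ 2 + q₁ ^ 2 + (p₂ ^ 2 + q₂ ^ 2)) * (x ^ 2 + y ^ 2)) := by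
  set P := c₁ * p₁ + c₂ * p₂ with hP
  set Q := c₁ * q₁ + c₂ * q₂ with hQ
  have h1 : (p₁ * q₂ - q₁ * p₂) * (c₁ * x + c₂ * y)
      = P * (x * q₂ - y * q₁) + Q * (y * p₁ - x * p₂) := by rw [hP, hQ]; ring
  have h2 : (P * (x * q₂ - y * q₁) + Q * (y * p₁ - x * p₂)) ^ 2
      ≤ (P ^ 2 + Q ^ 2) * ((x * q₂ - y * q₁) ^ 2 + (y * p₁ - x * p₂) ^ 2) := by
    nlinarith [sq_nonneg (P * (y * p₁ - x * p₂) - Q * (x * q₂ - y * q₁))]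
  rw [h1]
  refine h2.trans (mul_le_mul_of_nonneg_left ?_ (by positivity))
  nlinarith [sq_nonneg (x * q₁ + y * q₂), sq_nonneg (x * p₁ + y * p₂)]

/-- If C has columns Re c, Im c and W is the image ΦC, then Φ = W adj(C)/det C. The right side is
the product of the squared Hilbert–Schmidt norms of W and C. -/
theorem opNorm_transfer_le (ha : ∀ n, a n ≠ 0) (ha0 : a 0 = 1) (E : ℝ) (u : ℕ → ℂ) (n : ℕ) :
    opNorm (transfer a b n E) ^ 2 * (a n * (u (n + 1) * star (u n)).im) ^ 2
      ≤ (‖u (n + 1)‖ ^ 2 + ‖u n‖ ^ 2) * ‖coords a b E u n‖ ^ 2 := by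
  have hd := det_coords (b := b) ha ha0 E u n
  set d := a n * (u (n + 1) * star (u n)).im with hdd
  have hns : ∀ w : ℂ, ‖w‖ ^ 2 = w.re ^ 2 + w.im ^ 2 := fun w => by
    rw [← Complex.normSq_eq_norm_sq, Complex.normSq_apply]; ring
  rcases eq_or_ne d 0 with h0 | h0
  · rw [h0]; simp only [ne_eq, OfNat.ofNat_ne_zero, not_false_eq_true, zero_pow, mul_zero]
    positivity
  have hd2 : 0 < d ^ 2 := by positivity
  rw [← le_div_iff₀ hd2]
  refine opNorm_sq_le (by positivity) fun v => ?_
  rw [div_mul_eq_mul_div, le_div_iff₀ hd2]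
  simp only [Fin.sum_univ_two, transfer, Matrix.mulVec, dotProduct, Matrix.of_apply,
    Matrix.cons_val_zero, Matrix.cons_val_one, Matrix.cons_val']
  have e1 := coords_succ_eq (b := b) ha ha0 E u n
  have e2 := coords_eq (b := b) ha ha0 E u n
  have hc : ‖coords a b E u n‖ ^ 2 = ‖coords a b E u n 0‖ ^ 2 + ‖coords a b E u n 1‖ ^ 2 := by
    rw [EuclideanSpace.norm_sq_eq, Fin.sum_univ_two]
  rw [hc]
  generalize coords a b E u n 0 = x at *
  generalize coords a b E u n 1 = y at *
  have k1 := sq_lin_comb_le (v 0) (v 1) x.re x.im y.re y.im (uSol a b 0 E (n + 1))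
    (uSol a b (Real.pi / 2) E (n + 1))
  have k2 := sq_lin_comb_le (v 0) (v 1) x.re x.im y.re y.im (uSol a b 0 E n)
    (uSol a b (Real.pi / 2) E n)
  rw [hd] at k1 k2
  rw [← e1, ← e2, hns, hns, hns, hns]
  simp only [Complex.add_re, Complex.add_im, Complex.re_ofReal_mul, Complex.im_ofReal_mul]
  nlinarith [k1, k2]

/-- The comparison starts at site 1, not 0, because u(1) and u(2) are bounded by ‖φ‖ whereas u(0) =
-1 is not. This is where the factor ‖Φ(1,E)⁻¹‖ in the length scale comes from. -/
theorem norm_coords_one_sq_le (ha : ∀ n, a n ≠ 0) (ha0 : a 0 = 1) (E : ℝ) (u : ℕ → ℂ) :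
    ‖coords a b E u 1‖ ^ 2 ≤ opNorm (transfer a b 1 E)⁻¹ ^ 2 * (‖u 1‖ ^ 2 + ‖u 2‖ ^ 2) := by
  have hdet : (transfer a b 1 E).det ≠ 0 := by
    rw [det_transfer ha ha0]; exact inv_ne_zero (ha 1)
  have e1 := coords_succ_eq (b := b) ha ha0 E u 1
  have e2 := coords_eq (b := b) ha ha0 E u 1
  have hns : ∀ w : ℂ, ‖w‖ ^ 2 = w.re ^ 2 + w.im ^ 2 := fun w => by
    rw [← Complex.normSq_eq_norm_sq, Complex.normSq_apply]; ring
  rw [EuclideanSpace.norm_sq_eq, Fin.sum_univ_two]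
  generalize coords a b E u 1 0 = x at *
  generalize coords a b E u 1 1 = y at *
  have k1 := sum_sq_le_opNorm_inv hdet ![x.re, y.re]
  have k2 := sum_sq_le_opNorm_inv hdet ![x.im, y.im]
  generalize opNorm (transfer a b 1 E)⁻¹ = p at *
  simp only [Fin.sum_univ_two, transfer, Matrix.mulVec, dotProduct, Matrix.of_apply,
    Matrix.cons_val_zero, Matrix.cons_val_one, Matrix.cons_val'] at k1 k2
  rw [← e1, ← e2, hns, hns, hns, hns]
  simp only [Complex.add_re, Complex.add_im, Complex.re_ofReal_mul, Complex.im_ofReal_mul]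
  linarith

end

/-! ### Truncated norms and the lower bound on the mass of a solution. -/

section

variable {a b : ℕ → ℝ}

/-- `truncNormSq` for sequences indexed by `ℕ`. -/
def truncSq (L : ℝ) (u : ℕ → ℂ) : ℝ :=
  ∑ n ∈ Finset.Icc 1 ⌊L⌋₊, ‖u n‖ ^ 2 + (L - ⌊L⌋₊) * ‖u (⌊L⌋₊ + 1)‖ ^ 2

theorem sum_Icc_le_truncSq {L : ℝ} (hL : 0 ≤ L) (u : ℕ → ℂ) :
    ∑ n ∈ Finset.Icc 1 ⌊L⌋₊, ‖u n‖ ^ 2 ≤ truncSq L u := by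
  have h1 : 0 ≤ L - ⌊L⌋₊ := sub_nonneg.2 (Nat.floor_le hL)
  unfold truncSq
  have : 0 ≤ (L - ⌊L⌋₊) * ‖u (⌊L⌋₊ + 1)‖ ^ 2 := by positivity
  linarith

theorem truncSq_mono (u : ℕ → ℂ) {L L' : ℝ} (hL : 0 ≤ L) (h : L ≤ L') :
    truncSq L u ≤ truncSq L' u := by
  have h1 : ⌊L⌋₊ ≤ ⌊L'⌋₊ := Nat.floor_le_floor h
  rcases h1.eq_or_lt with h2 | h2
  · unfold truncSq
    rw [h2]
    gcongr
  · refine le_trans ?_ (sum_Icc_le_truncSq (hL.trans h) u)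
    have h3 : ∑ n ∈ Finset.Icc 1 (⌊L⌋₊ + 1), ‖u n‖ ^ 2 ≤ ∑ n ∈ Finset.Icc 1 ⌊L'⌋₊, ‖u n‖ ^ 2 :=
      Finset.sum_le_sum_of_subset_of_nonneg (Finset.Icc_subset_Icc_right h2)
        fun _ _ _ => by positivity
    rw [Finset.sum_Icc_succ_top (by omega)] at h3
    have h4 : L - ⌊L⌋₊ ≤ 1 := by linarith [Nat.lt_floor_add_one L]
    have h5 := mul_le_mul_of_nonneg_right h4 (sq_nonneg ‖u (⌊L⌋₊ + 1)‖)
    unfold truncSq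
    linarith

theorem sum_pair_le_truncSq {L : ℝ} (hL : 1 ≤ L) (u : ℕ → ℂ) :
    ∑ n ∈ Finset.Icc 1 (⌊L⌋₊ - 1), (‖u (n + 1)‖ ^ 2 + ‖u n‖ ^ 2)
      + (L - ⌊L⌋₊) * (‖u (⌊L⌋₊ + 1)‖ ^ 2 + ‖u ⌊L⌋₊‖ ^ 2) ≤ 2 * truncSq L u := by
  have hN : 1 ≤ ⌊L⌋₊ := Nat.le_floor (by simpa using hL)
  have h4 : L - ⌊L⌋₊ ≤ 1 := by linarith [Nat.lt_floor_add_one L]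
  have h3 : 0 ≤ L - ⌊L⌋₊ := sub_nonneg.2 (Nat.floor_le (by linarith))
  unfold truncSq
  generalize ⌊L⌋₊ = N at *
  obtain ⟨k, rfl⟩ : ∃ k, N = k + 1 := ⟨N - 1, by omega⟩
  rw [Nat.add_sub_cancel, Finset.sum_add_distrib]
  have h5 := mul_le_mul_of_nonneg_right h4 (sq_nonneg ‖u (k + 1)‖)
  have h6 : ∑ n ∈ Finset.Icc 1 k, ‖u (n + 1)‖ ^ 2 = ∑ n ∈ Finset.Ioc 1 (k + 1), ‖u n‖ ^ 2 := by
    refine Finset.sum_bij (fun n _ => n + 1) (fun n hn => ?_) (fun _ _ _ _ h => by omega)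
      (fun n hn => ⟨n - 1, ?_, ?_⟩) fun _ _ => rfl
    · simp only [Finset.mem_Icc, Finset.mem_Ioc] at hn ⊢; omega
    · simp only [Finset.mem_Icc, Finset.mem_Ioc] at hn ⊢; omega
    · simp only [Finset.mem_Ioc] at hn; omega
  have h7 : ∑ n ∈ Finset.Ioc 1 (k + 1), ‖u n‖ ^ 2 ≤ ∑ n ∈ Finset.Icc 1 (k + 1), ‖u n‖ ^ 2 :=
    Finset.sum_le_sum_of_subset_of_nonneg Finset.Ioc_subset_Icc_self fun _ _ _ => by positivity
  have h8 := Finset.sum_Icc_succ_top (show 1 ≤ k + 1 by omega) fun n => ‖u n‖ ^ 2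
  have h9 := mul_nonneg h3 (sq_nonneg ‖u (k + 1 + 1)‖)
  rw [h6]
  linarith

/-- The key lower bound: at the length scale given by the growth of the transfer matrices at the
real energy `E`, a solution at a nearby complex energy `z` has a fixed fraction of its mass. -/
theorem im_le_truncSq (ha : ∀ n, a n ≠ 0) (ha0 : a 0 = 1) {E ε L : ℝ} {z : ℂ} {u : ℕ → ℂ}
    (hε : 0 < ε) (hz : z.im = ε) (hzE : ‖z - E‖ ^ 2 ≤ 2 * ε ^ 2) (hu : IsSolution a b z u)
    (hu0 : u 0 = -1) (hM : ε * (‖u 1‖ ^ 2 + ‖u 2‖ ^ 2) ≤ (u 1).im) (hL : 1 ≤ L)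
    (hT : transferNorm a b E L = 2 * opNorm (transfer a b 1 E)⁻¹ * ε⁻¹) :
    (u 1).im / 8 ≤ ε * truncSq L u := by
  have hN : 1 ≤ ⌊L⌋₊ := Nat.le_floor (by simpa using hL)
  have hfrac : 0 ≤ L - ⌊L⌋₊ := sub_nonneg.2 (Nat.floor_le (by linarith))
  have hdet : (transfer a b 1 E).det ≠ 0 := by
    rw [det_transfer ha ha0]; exact inv_ne_zero (ha 1)
  have hp := opNorm_inv_pos hdet
  have hv1 := norm_coords_one_sq_le (b := b) ha ha0 E u
  set p := opNorm (transfer a b 1 E)⁻¹ with hpdef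
  set M := (u 1).im with hMdef
  set s := truncSq L u with hs
  by_contra! hlt
  have hs0 : 0 ≤ s := by
    refine le_trans ?_ (sum_Icc_le_truncSq (by linarith) u)
    positivity
  have hMpos : 0 < M := by nlinarith
  have hTsq : transferSq a b E L = 4 * p ^ 2 / ε ^ 2 := by
    rw [← transferNorm_sq E hL, hT]; field_simp; ring
  have hsM : s ≤ M / ε / 8 := by
    rw [div_div, le_div_iff₀ (by positivity)]; linarith
  have hw1 : ‖u 1‖ ^ 2 + ‖u 2‖ ^ 2 ≤ M / ε := by
    rw [le_div_iff₀ hε]; linarith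
  -- Below, q² = M/ε bounds the initial data |u(1)|² + |u(2)|² and, up to the factor 1/8, the
  -- truncated mass s; in these terms M = εq².
  set q := √(M / ε) with hq
  have hq2 : q ^ 2 = M / ε := Real.sq_sqrt (by positivity)
  have hqpos : 0 < q := Real.sqrt_pos.2 (by positivity)
  have hc1 : ‖coords a b E u 1‖ ≤ p * q := by
    refine abs_le_of_sq_le_sq' ?_ (by positivity) |>.2
    rw [mul_pow, hq2]
    exact hv1.trans (by gcongr)
  obtain ⟨r, hr0, hr2⟩ : ∃ r : ℝ, 0 < r ∧ r ^ 2 = 2 :=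
    ⟨√2, by positivity, Real.sq_sqrt (by norm_num)⟩
  have hz1 : ‖z - E‖ ≤ r * ε := by
    refine abs_le_of_sq_le_sq' ?_ (by positivity) |>.2
    rw [mul_pow, hr2]; exact hzE
  have hcn : ∀ n, 1 ≤ n → n ≤ ⌊L⌋₊ → ‖coords a b E u n‖ ≤ 2 * (p * q) := by
    intro n hn hnL
    refine (norm_coords_le ha E hu hn).trans ?_
    have e1 : ∑ n ∈ Finset.Icc 1 n, ‖u n‖ ^ 2 ≤ q ^ 2 / 8 := by
      rw [hq2]
      refine le_trans ?_ ((sum_Icc_le_truncSq (by linarith) u).trans hsM)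
      exact Finset.sum_le_sum_of_subset_of_nonneg (Finset.Icc_subset_Icc_right hnL)
        fun _ _ _ => by positivity
    have e2 : ∑ n ∈ Finset.Icc 1 (n - 1), opNorm (transfer a b n E) ^ 2 ≤ 4 * p ^ 2 / ε ^ 2 := by
      rw [← hTsq, transferSq]
      have e3 : ∑ n ∈ Finset.Icc 1 (n - 1), opNorm (transfer a b n E) ^ 2
          ≤ ∑ n ∈ Finset.Icc 1 (⌊L⌋₊ - 1), opNorm (transfer a b n E) ^ 2 :=
        Finset.sum_le_sum_of_subset_of_nonneg (Finset.Icc_subset_Icc_right (by omega))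
          fun _ _ _ => by positivity
      have e4 : 0 ≤ (L - ⌊L⌋₊) * opNorm (transfer a b ⌊L⌋₊ E) ^ 2 := by positivity
      linarith
    have e7 : 0 ≤ ∑ n ∈ Finset.Icc 1 (n - 1), opNorm (transfer a b n E) ^ 2 :=
      Finset.sum_nonneg fun _ _ => sq_nonneg _
    generalize ∑ n ∈ Finset.Icc 1 n, ‖u n‖ ^ 2 = X at e1 ⊢
    generalize ∑ n ∈ Finset.Icc 1 (n - 1), opNorm (transfer a b n E) ^ 2 = Y at e2 e7 ⊢
    -- Exactly (q²/8)(4p²/ε²) = (pq/(√2 ε))². Against |z - E| ≤ √2 ε, the growth of the coordinates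
    -- is therefore at most pq, the same as their initial bound.
    have e5 : √(X * Y) ≤ p * q / (r * ε) := by
      rw [Real.sqrt_le_left (by positivity)]
      have e8 : (p * q / (r * ε)) ^ 2 = q ^ 2 / 8 * (4 * p ^ 2 / ε ^ 2) := by
        rw [div_pow, mul_pow, mul_pow, hr2]
        field_simp
        norm_num
      rw [e8]
      exact mul_le_mul e1 e2 e7 (by positivity)
    have e6 : ‖z - E‖ * √(X * Y) ≤ (r * ε) * (p * q / (r * ε)) :=
      mul_le_mul hz1 e5 (Real.sqrt_nonneg _) (by positivity)
    rw [mul_div_cancel₀ _ (by positivity)] at e6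
    linarith
  have hΦ : ∀ n, 1 ≤ n → n ≤ ⌊L⌋₊ → opNorm (transfer a b n E) ^ 2
      ≤ 16 * p ^ 2 / (ε ^ 2 * q ^ 2) * (‖u (n + 1)‖ ^ 2 + ‖u n‖ ^ 2) := by
    intro n hn hnL
    have e1 := opNorm_transfer_le (b := b) ha ha0 E u n
    have e2 : ∑ k ∈ Finset.Icc 1 n, ‖u k‖ ^ 2 ≤ s :=
      le_trans (Finset.sum_le_sum_of_subset_of_nonneg (Finset.Icc_subset_Icc_right hnL)
        fun _ _ _ => by positivity) (sum_Icc_le_truncSq (by linarith) u)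
    -- The flux has lost at most εs < M/8 of its initial value M.
    have e3 : M / 2 ≤ -(a n * (u (n + 1) * star (u n)).im) := by
      rw [flux_eq hu ha0 hu0, hz]
      nlinarith [mul_le_mul_of_nonneg_left e2 hε.le]
    have e4 : (M / 2) ^ 2 ≤ (a n * (u (n + 1) * star (u n)).im) ^ 2 := by
      rw [← neg_sq (a n * _)]
      exact pow_le_pow_left₀ (by positivity) e3 2
    have e5 : ‖coords a b E u n‖ ^ 2 ≤ (2 * (p * q)) ^ 2 :=
      pow_le_pow_left₀ (norm_nonneg _) (hcn n hn hnL) 2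
    have e6 : opNorm (transfer a b n E) ^ 2 * (M / 2) ^ 2
        ≤ (‖u (n + 1)‖ ^ 2 + ‖u n‖ ^ 2) * (2 * (p * q)) ^ 2 :=
      (mul_le_mul_of_nonneg_left e4 (by positivity)).trans
        (e1.trans (mul_le_mul_of_nonneg_left e5 (by positivity)))
    have e7 : M = ε * q ^ 2 := by rw [hq2]; field_simp
    rw [e7] at e6
    rw [div_mul_eq_mul_div, le_div_iff₀ (by positivity)]
    have e8 : 0 < q ^ 2 := by positivity
    refine le_of_mul_le_mul_right ?_ e8
    linarith
  have hfinal : transferSq a b E L ≤ 16 * p ^ 2 / (ε ^ 2 * q ^ 2) * (2 * s) := by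
    have e1 := mul_le_mul_of_nonneg_left (sum_pair_le_truncSq hL u)
      (show 0 ≤ 16 * p ^ 2 / (ε ^ 2 * q ^ 2) by positivity)
    refine le_trans ?_ e1
    rw [transferSq, mul_add, Finset.mul_sum, mul_left_comm]
    refine add_le_add (Finset.sum_le_sum fun n hn => ?_)
      (mul_le_mul_of_nonneg_left (hΦ _ hN le_rfl) hfrac)
    rw [Finset.mem_Icc] at hn
    exact hΦ n hn.1 (by omega)
  -- Inserting ‖Φ‖_L² = 4p²/ε² leaves q² ≤ 8s, that is M ≤ 8εs, against the assumption.
  rw [hTsq, div_mul_eq_mul_div, div_le_div_iff₀ (by positivity) (by positivity)] at hfinal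
  have h1 : (4 * p ^ 2 * ε ^ 2) * q ^ 2 ≤ (4 * p ^ 2 * ε ^ 2) * (8 * s) := by linarith
  have h2 := le_of_mul_le_mul_left h1 (by positivity)
  rw [hq2, div_le_iff₀ hε] at h2
  linarith

end

/-! ## Plancherel's theorem for integrable square-integrable functions -/

section

open scoped FourierTransform ContDiff

theorem continuous_fourier_of_integrable {f : ℝ → ℂ} (hf : Integrable f) : Continuous (𝓕 f) :=
  VectorFourier.fourierIntegral_continuous Real.continuous_fourierChar
    (innerSL ℝ).continuous₂ hf

/-- Identifies the L² Fourier transform with the Fourier integral: both have the same pairing with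
every test function, by ∫ f 𝓕φ = ∫ φ 𝓕f. -/
theorem fourier_toLp_ae_eq {f : ℝ → ℂ} (hf : Integrable f) (hf2 : MemLp f 2) :
    ∀ᵐ x : ℝ, (𝓕 (hf2.toLp f : Lp ℂ 2 (volume : Measure ℝ)) : Lp ℂ 2 (volume : Measure ℝ)) x
      = 𝓕 f x := by
  set G : Lp ℂ 2 (volume : Measure ℝ) := 𝓕 (hf2.toLp f : Lp ℂ 2 (volume : Measure ℝ)) with hG
  refine ae_eq_of_integral_contDiff_smul_eq ((Lp.memLp G).locallyIntegrable (by norm_num))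
    (continuous_fourier_of_integrable hf).locallyIntegrable fun g g_smooth g_cpt => ?_
  have hg₁ : HasCompactSupport (Complex.ofRealCLM ∘ g) := g_cpt.comp_left rfl
  have hg₂ : ContDiff ℝ ∞ (Complex.ofRealCLM ∘ g) := by fun_prop
  set φ : SchwartzMap ℝ ℂ := hg₁.toSchwartzMap hg₂ with hφ
  have hφg : ∀ x, φ x = (g x : ℂ) := fun x => rfl
  have h1 : ∫ x, g x • G x = Lp.toTemperedDistribution G φ := by
    rw [Lp.toTemperedDistribution_apply]
    rfl
  have h2 : Lp.toTemperedDistribution G φ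
      = Lp.toTemperedDistribution (hf2.toLp f : Lp ℂ 2 (volume : Measure ℝ)) (𝓕 φ) := by
    rw [hG, ← Lp.fourier_toTemperedDistribution_eq, TemperedDistribution.fourier_apply]
  have h3 : Lp.toTemperedDistribution (hf2.toLp f : Lp ℂ 2 (volume : Measure ℝ)) (𝓕 φ)
      = ∫ x, (𝓕 φ) x • f x := by
    rw [Lp.toTemperedDistribution_apply]
    refine integral_congr_ae ?_
    filter_upwards [hf2.coeFn_toLp] with x hx
    rw [hx]
  have h4 : ∫ x, (𝓕 φ) x • f x = ∫ x, φ x • 𝓕 f x := by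
    have h5 := VectorFourier.integral_fourierIntegral_smul_eq_flip (L := innerₗ ℝ)
      (μ := (volume : Measure ℝ)) (ν := (volume : Measure ℝ))
      Real.continuous_fourierChar continuous_inner φ.integrable hf
    rw [flip_innerₗ] at h5
    exact h5
  rw [h1, h2, h3, h4]
  rfl

theorem integral_norm_sq_fourier {f : ℝ → ℂ} (hf : Integrable f) (hf2 : MemLp f 2) :
    Integrable (fun x => ‖𝓕 f x‖ ^ 2) ∧ ∫ x, ‖𝓕 f x‖ ^ 2 = ∫ x, ‖f x‖ ^ 2 := by
  have hae := fourier_toLp_ae_eq hf hf2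
  set F : Lp ℂ 2 (volume : Measure ℝ) := hf2.toLp f with hF
  have hmem : MemLp (𝓕 f) 2 := (memLp_congr_ae hae).1 (Lp.memLp (𝓕 F))
  refine ⟨(memLp_two_iff_integrable_sq_norm hmem.1).1 hmem, ?_⟩
  have h1 : ∀ G : Lp ℂ 2 (volume : Measure ℝ), ∫ x, ‖G x‖ ^ 2 = ‖G‖ ^ 2 := fun G => by
    have h2 : (inner ℂ G G : ℂ) = ((‖G‖ ^ 2 : ℝ) : ℂ) := by
      rw [inner_self_eq_norm_sq_to_K]; norm_cast
    have h3 : ∫ x, (inner ℂ (G x) (G x) : ℂ) = ((∫ x, ‖G x‖ ^ 2 : ℝ) : ℂ) := by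
      refine Eq.trans ?_ integral_complex_ofReal
      congr 1; ext x
      rw [inner_self_eq_norm_sq_to_K]; norm_cast
    refine Complex.ofReal_injective ?_
    rw [← h2, ← h3, L2.inner_def]
  calc ∫ x, ‖𝓕 f x‖ ^ 2 = ∫ x, ‖(𝓕 F : Lp ℂ 2 (volume : Measure ℝ)) x‖ ^ 2 :=
        integral_congr_ae (by filter_upwards [hae] with x hx; rw [hx])
    _ = ‖𝓕 F‖ ^ 2 := h1 _
    _ = ‖F‖ ^ 2 := by rw [Lp.norm_fourier_eq]
    _ = ∫ x, ‖F x‖ ^ 2 := (h1 F).symm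
    _ = ∫ x, ‖f x‖ ^ 2 :=
        integral_congr_ae (by filter_upwards [hf2.coeFn_toLp] with x hx; rw [hF, hx])

/-- Plancherel's theorem for one-sided Fourier transforms. -/
theorem integral_norm_sq_laplace {f : ℝ → ℂ} (hf : IntegrableOn f (Set.Ioi 0))
    (hf2 : IntegrableOn (fun t => ‖f t‖ ^ 2) (Set.Ioi 0)) :
    Continuous (fun s : ℝ => ∫ t in Set.Ioi (0 : ℝ), Complex.exp (Complex.I * s * t) * f t) ∧
    Integrable (fun s : ℝ =>
      ‖∫ t in Set.Ioi (0 : ℝ), Complex.exp (Complex.I * s * t) * f t‖ ^ 2) ∧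
    ∫ s : ℝ, ‖∫ t in Set.Ioi (0 : ℝ), Complex.exp (Complex.I * s * t) * f t‖ ^ 2
      = 2 * Real.pi * ∫ t in Set.Ioi (0 : ℝ), ‖f t‖ ^ 2 := by
  set F : ℝ → ℂ := (Set.Ioi 0).indicator f with hF
  have h1 : Integrable F := (integrable_indicator_iff measurableSet_Ioi).2 hf
  have hsq : (fun t => ‖F t‖ ^ 2) = (Set.Ioi 0).indicator fun t => ‖f t‖ ^ 2 := by
    funext t
    by_cases ht : t ∈ Set.Ioi (0 : ℝ)
    · rw [hF, Set.indicator_of_mem ht, Set.indicator_of_mem ht]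
    · rw [hF, Set.indicator_of_notMem ht, Set.indicator_of_notMem ht]; simp
  have h2 : MemLp F 2 := by
    rw [memLp_two_iff_integrable_sq_norm h1.1, hsq]
    exact (integrable_indicator_iff measurableSet_Ioi).2 hf2
  obtain ⟨h3, h4⟩ := integral_norm_sq_fourier h1 h2
  set g : ℝ → ℂ := fun s => ∫ t in Set.Ioi (0 : ℝ), Complex.exp (Complex.I * s * t) * f t with hg
  have h5 : ∀ w : ℝ, 𝓕 F w = g (-2 * Real.pi * w) := fun w => by
    rw [Real.fourier_real_eq_integral_exp_smul, hg]
    simp only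
    rw [← integral_indicator measurableSet_Ioi]
    congr 1; funext t
    by_cases ht : t ∈ Set.Ioi (0 : ℝ)
    · rw [hF, Set.indicator_of_mem ht, Set.indicator_of_mem ht, smul_eq_mul]
      congr 2
      push_cast; ring
    · rw [hF, Set.indicator_of_notMem ht, Set.indicator_of_notMem ht, smul_zero]
  -- The substitution s = -2πw between the two normalisations produces the factor 2π.
  have hne : -2 * Real.pi ≠ 0 := by simp [Real.pi_ne_zero]
  have h6 : g = fun s => 𝓕 F ((-2 * Real.pi)⁻¹ * s) := by
    funext s
    rw [h5, mul_inv_cancel_left₀ hne]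
  refine ⟨?_, ?_, ?_⟩
  · rw [h6]
    exact (continuous_fourier_of_integrable h1).comp (continuous_const.mul continuous_id)
  · change Integrable fun s => ‖g s‖ ^ 2
    rw [h6]
    exact h3.comp_mul_left' (inv_ne_zero hne)
  · have h7 := Measure.integral_comp_mul_left (fun s => ‖g s‖ ^ 2) (-2 * Real.pi)
    simp only [← h5] at h7
    rw [h4, hsq, integral_indicator measurableSet_Ioi, abs_inv, neg_mul, abs_neg,
      abs_of_pos Real.two_pi_pos, smul_eq_mul] at h7
    rw [h7, mul_inv_cancel_left₀ Real.two_pi_pos.ne']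

end

/-! ## Averaging over the energy -/

theorem poisson_im (x E ε : ℝ) :
    (((x : ℂ) - (E + ε * Complex.I))⁻¹).im = ε / ((x - E) ^ 2 + ε ^ 2) := by
  rw [Complex.inv_im, Complex.normSq_apply]
  simp
  ring

theorem continuous_poisson {ε : ℝ} (hε : 0 < ε) :
    Continuous fun p : ℝ × ℝ => ε / ((p.1 - p.2) ^ 2 + ε ^ 2) := by
  refine Continuous.div continuous_const (by fun_prop) fun p => ?_
  positivity

theorem poisson_le (x E : ℝ) {ε : ℝ} (hε : 0 < ε) : ε / ((x - E) ^ 2 + ε ^ 2) ≤ ε⁻¹ := by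
  rw [div_le_iff₀ (by positivity), ← div_eq_inv_mul, le_div_iff₀ hε]
  nlinarith [sq_nonneg (x - E)]

theorem integrable_poisson {μ : Measure ℝ} [IsFiniteMeasure μ] (E : ℝ) {ε : ℝ} (hε : 0 < ε) :
    Integrable (fun x => ε / ((x - E) ^ 2 + ε ^ 2)) μ := by
  refine Integrable.mono' (integrable_const ε⁻¹) ?_ (Eventually.of_forall fun x => ?_)
  · exact ((continuous_poisson hε).comp
      (by fun_prop : Continuous fun x : ℝ => (x, E))).aestronglyMeasurable
  · rw [Real.norm_eq_abs, abs_of_nonneg (by positivity)]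
    exact poisson_le x E hε

theorem im_integral_inv_sub {μ : Measure ℝ} [IsFiniteMeasure μ] (E : ℝ) {ε : ℝ} (hε : 0 < ε) :
    (∫ x : ℝ, ((x : ℂ) - (E + ε * Complex.I))⁻¹ ∂μ).im = ∫ x, ε / ((x - E) ^ 2 + ε ^ 2) ∂μ := by
  have hne : ∀ x : ℝ, (x : ℂ) - (E + ε * Complex.I) ≠ 0 := fun x h => by
    have h1 := congrArg Complex.im h
    simp at h1
    exact hε.ne' h1
  have hint : Integrable (fun x : ℝ => ((x : ℂ) - (E + ε * Complex.I))⁻¹) μ := by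
    refine Integrable.mono' (integrable_const ε⁻¹) ?_ (Eventually.of_forall fun x => ?_)
    · have : Continuous fun x : ℝ => ((x : ℂ) - (E + ε * Complex.I))⁻¹ :=
        Continuous.inv₀ (by fun_prop) hne
      exact this.aestronglyMeasurable
    · rw [norm_inv]
      refine inv_anti₀ hε ?_
      refine le_trans ?_ (Complex.abs_im_le_norm _)
      simp [abs_of_pos hε]
  have h1 := Complex.imCLM.integral_comp_comm hint
  simp only [Complex.imCLM_apply, poisson_im] at h1
  exact h1.symm

/-- On |E - x| ≤ ε the kernel is at least 1/(2ε), and this interval has length 2ε. -/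
theorem one_le_lintegral_poisson {D : Set ℝ} {x ε : ℝ} (hε : 0 < ε)
    (hD : ∀ E, |E - x| ≤ ε → E ∈ D) :
    1 ≤ ∫⁻ E in D, ENNReal.ofReal (ε / ((x - E) ^ 2 + ε ^ 2)) := by
  have hsub : Set.Icc (x - ε) (x + ε) ⊆ D := fun E hE =>
    hD E (abs_le.2 ⟨by linarith [hE.1], by linarith [hE.2]⟩)
  calc (1 : ENNReal) = ENNReal.ofReal (1 / (2 * ε)) * volume (Set.Icc (x - ε) (x + ε)) := by
        rw [Real.volume_Icc, ← ENNReal.ofReal_mul (by positivity), ← ENNReal.ofReal_one]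
        congr 1
        field_simp
        ring
    _ = ∫⁻ E in Set.Icc (x - ε) (x + ε), ENNReal.ofReal (1 / (2 * ε)) :=
        (setLIntegral_const _ _).symm
    _ ≤ ∫⁻ E in Set.Icc (x - ε) (x + ε), ENNReal.ofReal (ε / ((x - E) ^ 2 + ε ^ 2)) := by
        refine setLIntegral_mono' measurableSet_Icc fun E hE => ENNReal.ofReal_le_ofReal ?_
        rw [div_le_div_iff₀ (by positivity) (by positivity)]
        have h1 : (x - E) ^ 2 ≤ ε ^ 2 := by
          rw [sq_le_sq, abs_of_pos hε]
          exact abs_le.2 ⟨by linarith [hE.2], by linarith [hE.1]⟩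
        nlinarith
    _ ≤ _ := lintegral_mono_set hsub

/-- If the Poisson integral `M` of `μ` is dominated by `h` at distance at most `ε` from `S`, then
`μ S` is dominated by the integral of `h`. -/
theorem measureReal_le_integral {μ : Measure ℝ} [IsFiniteMeasure μ] {h M : ℝ → ℝ} {c ε : ℝ}
    (hε : 0 < ε) (hc : 0 ≤ c) (hh : Continuous h) (hh0 : ∀ E, 0 ≤ h E) (hint : Integrable h)
    (hM : Continuous M) (hMμ : ∀ E, M E = ∫ x, ε / ((x - E) ^ 2 + ε ^ 2) ∂μ) {S : Set ℝ}
    (hS : ∀ x ∈ S, ∀ E, |E - x| ≤ ε → M E ≤ c * h E) : μ.real S ≤ c * ∫ E, h E := by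
  set D : Set ℝ := {E | M E ≤ c * h E} with hDdef
  have hD : MeasurableSet D := (isClosed_le hM (continuous_const.mul hh)).measurableSet
  have hmeas : Measurable fun p : ℝ × ℝ => ENNReal.ofReal (ε / ((p.1 - p.2) ^ 2 + ε ^ 2)) :=
    (continuous_poisson hε).measurable.ennreal_ofReal
  have hMl : ∀ E, ∫⁻ x, ENNReal.ofReal (ε / ((x - E) ^ 2 + ε ^ 2)) ∂μ = ENNReal.ofReal (M E) :=
    fun E => by
      rw [hMμ, ofReal_integral_eq_lintegral_ofReal (integrable_poisson E hε)]
      exact Eventually.of_forall fun x => by positivity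
  have hI : 0 ≤ ∫ E, h E := integral_nonneg hh0
  have key : μ S ≤ ENNReal.ofReal (c * ∫ E, h E) := by
    -- `S` need not be measurable, so it is enlarged to a level set; Markov's inequality and Tonelli
    -- then bring in M.
    calc μ S ≤ μ {x | 1 ≤ ∫⁻ E in D, ENNReal.ofReal (ε / ((x - E) ^ 2 + ε ^ 2))} :=
          measure_mono fun x hx => one_le_lintegral_poisson hε fun E hE => hS x hx E hE
      _ ≤ ∫⁻ x, (∫⁻ E in D, ENNReal.ofReal (ε / ((x - E) ^ 2 + ε ^ 2))) ∂μ := by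
          have h1 := mul_meas_ge_le_lintegral₀ (μ := μ)
            (f := fun x => ∫⁻ E in D, ENNReal.ofReal (ε / ((x - E) ^ 2 + ε ^ 2)))
            (Measurable.lintegral_prod_right hmeas).aemeasurable 1
          rwa [one_mul] at h1
      _ = ∫⁻ E in D, (∫⁻ x, ENNReal.ofReal (ε / ((x - E) ^ 2 + ε ^ 2)) ∂μ) :=
          lintegral_lintegral_swap hmeas.aemeasurable
      _ = ∫⁻ E in D, ENNReal.ofReal (M E) := by simp only [hMl]
      _ ≤ ∫⁻ E in D, ENNReal.ofReal (c * h E) :=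
          setLIntegral_mono' hD fun E hE => ENNReal.ofReal_le_ofReal hE
      _ ≤ ∫⁻ E, ENNReal.ofReal (c * h E) := setLIntegral_le_lintegral _ _
      _ = ENNReal.ofReal (c * ∫ E, h E) := by
          rw [← integral_const_mul, ofReal_integral_eq_lintegral_ofReal (hint.const_mul c)]
          exact Eventually.of_forall fun E => mul_nonneg hc (hh0 E)
  rw [measureReal_def]
  exact ENNReal.toReal_le_of_le_ofReal (mul_nonneg hc hI) key

/-! ## The resolvent at `δ₁` -/

section

variable {a b : ℕ → ℝ}

/-- The weights in `truncNormSq`. -/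
def weight (L : ℝ) (n : ℕ) : ℝ := if n ≤ ⌊L⌋₊ then 1 else L - ⌊L⌋₊

theorem truncNormSq_eq_sum (L : ℝ) (φ : ℕ+ → ℂ) :
    truncNormSq L φ = ∑ n ∈ Finset.Icc 1 (⌊L⌋₊ + 1), weight L n * ‖ext φ n‖ ^ 2 := by
  rw [Finset.sum_Icc_succ_top (by omega), truncNormSq]
  congr 1
  · refine Finset.sum_congr rfl fun n hn => ?_
    rw [weight, if_pos (Finset.mem_Icc.1 hn).2, one_mul]
  · rw [weight, if_neg (by omega)]

/-- The resolvent vector `φ = (H₊ - z)⁻¹ δ₁` extended by `φ(0) = -1`. -/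
def greenSeq (φ : HalfLine) (n : ℕ) : ℂ := if n = 0 then -1 else ext φ n

theorem greenSeq_succ (φ : HalfLine) (n : ℕ) : greenSeq φ (n + 1) = ext φ (n + 1) := by
  simp [greenSeq]

theorem truncSq_greenSeq {L : ℝ} (φ : HalfLine) : truncSq L (greenSeq φ) = truncNormSq L φ := by
  unfold truncSq truncNormSq
  rw [greenSeq_succ]
  congr 1
  refine Finset.sum_congr rfl fun n hn => ?_
  rw [greenSeq, if_neg (by have := (Finset.mem_Icc.1 hn).1; omega)]

/-- The source δ₁ at site 1 equals -a(0)u(0) when a(0) = 1 and u(0) = -1, so the inhomogeneous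
equation becomes homogeneous. -/
theorem isSolution_greenSeq (ha0 : a 0 = 1) {z : ℂ} {φ : HalfLine}
    (h : (φ, delta1 + z • φ) ∈ (halfLineOp a b).graph) : IsSolution a b z (greenSeq φ) := by
  intro n
  have h1 := (ext_coe _ n.succPNat).trans (mem_halfLineOp_graph.1 h n.succPNat)
  rw [lp.coeFn_add, ext_add, lp.coeFn_smul, ext_smul, formal, Nat.succPNat_coe,
    Nat.succ_eq_add_one, Nat.add_sub_cancel, ← site_one, ext_site] at h1
  rw [greenSeq_succ, greenSeq_succ]
  rcases n.eq_zero_or_pos with rfl | hn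
  · rw [ext_zero] at h1
    simp only [greenSeq, ha0, if_true] at h1 ⊢
    norm_num at h1 ⊢
    linear_combination -h1
  · obtain ⟨k, rfl⟩ : ∃ k, n = k + 1 := ⟨n - 1, by omega⟩
    rw [greenSeq_succ]
    simp only [show k + 1 + 1 ≠ 1 by omega, false_and, if_false] at h1
    linear_combination -h1

theorem inner_delta1 (φ : HalfLine) : inner ℂ delta1 φ = greenSeq φ 1 := by
  rw [← site_one, inner_site, greenSeq_succ]

theorem im_greenSeq_one (hA : IsSymmetricOp (halfLineOp a b)) {z : ℂ} {φ : HalfLine}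
    (h : (φ, delta1 + z • φ) ∈ (halfLineOp a b).graph) :
    (greenSeq φ 1).im = z.im * ‖φ‖ ^ 2 := by
  rw [← inner_delta1]; exact hA.im_inner h

theorem two_terms_le (φ : HalfLine) : ‖greenSeq φ 1‖ ^ 2 + ‖greenSeq φ 2‖ ^ 2 ≤ ‖φ‖ ^ 2 := by
  rw [norm_sq_eq_tsum_ext, greenSeq_succ, greenSeq_succ]
  have h1 := Summable.sum_le_tsum (Finset.range 2) (fun k _ => by positivity)
    ((summable_nat_add_iff 1).2 (summable_ext_sq φ))
  simpa [Finset.sum_range_succ] using h1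

/-- If u(1) = u(2) = 0, the equation at site 1 would force a(0)u(0) = 0. This needs both sites
inside the truncation, hence 2 ≤ L. -/
theorem truncNormSq_pos (ha0 : a 0 = 1) {z : ℂ} {φ : HalfLine}
    (h : (φ, delta1 + z • φ) ∈ (halfLineOp a b).graph) {L : ℝ} (hL : 2 ≤ L) :
    0 < truncNormSq L φ := by
  rw [← truncSq_greenSeq]
  refine lt_of_lt_of_le ?_ (sum_Icc_le_truncSq (by linarith) _)
  have hN : 2 ≤ ⌊L⌋₊ := Nat.le_floor (by simpa using hL)
  by_contra! hle
  have hzero : ∀ n ∈ Finset.Icc 1 ⌊L⌋₊, ‖greenSeq φ n‖ ^ 2 = 0 :=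
    (Finset.sum_eq_zero_iff_of_nonneg fun _ _ => by positivity).1
      (le_antisymm hle (Finset.sum_nonneg fun _ _ => by positivity))
  have h1 : greenSeq φ 1 = 0 := by
    simpa using hzero 1 (Finset.mem_Icc.2 ⟨le_rfl, by omega⟩)
  have h2 : greenSeq φ 2 = 0 := by
    simpa using hzero 2 (Finset.mem_Icc.2 ⟨by omega, hN⟩)
  have h3 := isSolution_greenSeq ha0 h 0
  rw [zero_add, h1, h2] at h3
  simp [greenSeq, ha0] at h3

end

/-! ### Parseval's identity for the resolvent and the final estimate. -/

section

variable {a b : ℕ → ℝ}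

theorem laplace_kernel_split (E ε t : ℝ) (w : ℂ) :
    Complex.exp (Complex.I * (E + ε * Complex.I) * t) * w
      = Complex.exp (Complex.I * E * t) * ((Real.exp (-ε * t) : ℂ) * w) := by
  rw [← mul_assoc, Complex.ofReal_exp, ← Complex.exp_add]
  congr 2
  push_cast
  linear_combination (ε * t : ℂ) * Complex.I_mul_I

theorem norm_sq_exp_mul (ε t : ℝ) (w : ℂ) :
    ‖(Real.exp (-ε * t) : ℂ) * w‖ ^ 2 = Real.exp (-(2 * ε) * t) * ‖w‖ ^ 2 := by
  rw [norm_mul, mul_pow, Complex.norm_real, Real.norm_eq_abs, sq_abs, ← Real.exp_nat_mul]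
  congr 2
  push_cast; ring

/-- Parseval's identity between the time evolution and the resolvent, at a single site. -/
theorem integral_norm_sq_resolvent {A : HalfLine →ₗ.[ℂ] HalfLine} {U : ℝ → HalfLine →L[ℂ] HalfLine}
    (hU : IsUnitaryGroupOf A U) {ψ : HalfLine} {ε : ℝ} (hε : 0 < ε) {φ : ℝ → HalfLine}
    (hφ : ∀ E : ℝ, (φ E, ψ + ((E : ℂ) + ε * Complex.I) • φ E) ∈ A.graph) (n : ℕ) :
    Continuous (fun E => ext (φ E) n) ∧ Integrable (fun E => ‖ext (φ E) n‖ ^ 2) ∧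
      IntegrableOn (fun t => Real.exp (-(2 * ε) * t) * ‖ext (U t ψ) n‖ ^ 2) (Set.Ioi 0) ∧
      ∫ E, ‖ext (φ E) n‖ ^ 2 = 2 * Real.pi
        * ∫ t in Set.Ioi (0 : ℝ), Real.exp (-(2 * ε) * t) * ‖ext (U t ψ) n‖ ^ 2 := by
  have him : ∀ E : ℝ, ((E : ℂ) + ε * Complex.I).im = ε := fun E => by simp
  set f : ℝ → ℂ := fun t => (Real.exp (-ε * t) : ℂ) * ext (U t ψ) n with hf
  have hcont : Continuous fun t => ext (U t ψ) n := by
    simp only [← inner_site]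
    exact continuous_const.inner (hU.continuous ψ)
  have hfi : IntegrableOn f (Set.Ioi 0) := by
    have h1 := hU.integrableOn_laplace_kernel (z := ((0 : ℝ) : ℂ) + ε * Complex.I)
      (by rw [him]; exact hε) (site n) ψ
    simp only [laplace_kernel_split] at h1
    simpa only [inner_site, Complex.ofReal_zero, mul_zero, zero_mul, Complex.exp_zero,
      one_mul] using h1
  have hbd : ∀ t, ‖ext (U t ψ) n‖ ≤ ‖site n‖ * ‖ψ‖ := fun t => by
    rw [← inner_site, ← hU.norm_apply t ψ]
    exact norm_inner_le_norm _ _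
  have hfsq : (fun t => ‖f t‖ ^ 2) = fun t => Real.exp (-(2 * ε) * t) * ‖ext (U t ψ) n‖ ^ 2 :=
    funext fun t => norm_sq_exp_mul ε t _
  have hfi2 : IntegrableOn (fun t => ‖f t‖ ^ 2) (Set.Ioi 0) := by
    rw [hfsq]
    have h1 : IntegrableOn (fun t : ℝ => Real.exp (-(2 * ε) * t) * (‖site n‖ * ‖ψ‖) ^ 2)
        (Set.Ioi 0) := (exp_neg_integrableOn_Ioi 0 (by positivity)).mul_const _
    refine Integrable.mono' h1 ?_ (Eventually.of_forall fun t => ?_)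
    · have : Continuous fun t => Real.exp (-(2 * ε) * t) * ‖ext (U t ψ) n‖ ^ 2 := by fun_prop
      exact this.aestronglyMeasurable
    · rw [Real.norm_eq_abs, abs_of_nonneg (by positivity)]
      gcongr
      exact hbd t
  have hφf : ∀ E : ℝ, ext (φ E) n
      = Complex.I * ∫ t in Set.Ioi (0 : ℝ), Complex.exp (Complex.I * E * t) * f t := fun E => by
    rw [← inner_site, hU.inner_resolvent (by rw [him]; exact hε) (hφ E) (site n)]
    simp only [laplace_kernel_split, inner_site, hf]
  have hnorm : (fun E => ‖ext (φ E) n‖ ^ 2)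
      = fun E : ℝ => ‖∫ t in Set.Ioi (0 : ℝ), Complex.exp (Complex.I * E * t) * f t‖ ^ 2 := by
    funext E
    rw [hφf, norm_mul, Complex.norm_I, one_mul]
  obtain ⟨h1, h2, h3⟩ := integral_norm_sq_laplace hfi hfi2
  refine ⟨?_, ?_, ?_, ?_⟩
  · simp only [hφf]
    exact continuous_const.mul h1
  · rw [hnorm]; exact h2
  · rw [← hfsq]; exact hfi2
  · rw [hnorm, h3, hfsq]

/-- The time average of the truncated norm is an energy average of the truncated norm of the
resolvent. -/
theorem timeAvg_truncNormSq {A : HalfLine →ₗ.[ℂ] HalfLine} {U : ℝ → HalfLine →L[ℂ] HalfLine}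
    (hU : IsUnitaryGroupOf A U) {ψ : HalfLine} {T : ℝ} (hT : 0 < T) {φ : ℝ → HalfLine}
    (hφ : ∀ E : ℝ, (φ E, ψ + ((E : ℂ) + (T⁻¹ : ℝ) * Complex.I) • φ E) ∈ A.graph) (L : ℝ) :
    Continuous (fun E => truncNormSq L (φ E)) ∧ Integrable (fun E => truncNormSq L (φ E)) ∧
      timeAvg T (fun t => truncNormSq L (U t ψ))
        = T⁻¹ / Real.pi * ∫ E, truncNormSq L (φ E) := by
  have hε : 0 < T⁻¹ := inv_pos.2 hT
  have key := integral_norm_sq_resolvent hU hε hφ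
  simp only [truncNormSq_eq_sum]
  refine ⟨?_, ?_, ?_⟩
  · exact continuous_finsetSum _ fun n _ => continuous_const.mul ((key n).1.norm.pow 2)
  · exact integrable_finsetSum _ fun n _ => (key n).2.1.const_mul _
  · rw [integral_finsetSum _ fun n _ => (key n).2.1.const_mul _, timeAvg]
    have h1 : ∀ t : ℝ, Real.exp (-2 * t / T)
        * ∑ n ∈ Finset.Icc 1 (⌊L⌋₊ + 1), weight L n * ‖ext (U t ψ) n‖ ^ 2
        = ∑ n ∈ Finset.Icc 1 (⌊L⌋₊ + 1),
          weight L n * (Real.exp (-(2 * T⁻¹) * t) * ‖ext (U t ψ) n‖ ^ 2) := fun t => by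
      rw [Finset.mul_sum]
      refine Finset.sum_congr rfl fun n _ => ?_
      rw [show -2 * t / T = -(2 * T⁻¹) * t by field_simp]
      ring
    simp only [h1]
    rw [integral_finsetSum _ fun n _ => (key n).2.2.1.const_mul _, Finset.mul_sum, Finset.mul_sum]
    refine Finset.sum_congr rfl fun n _ => ?_
    -- The prefactor 2/T divided by Plancherel's 2π is T⁻¹/π.
    rw [integral_const_mul, integral_const_mul, (key n).2.2.2]
    field_simp [Real.pi_ne_zero]

/-- A dynamical bound with the constant made explicit. -/
theorem muPlus_lt_timeAvg (ha : ∀ n, a n ≠ 0) (ha0 : a 0 = 1)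
    (hsum : ¬ Summable fun n : ℕ => |a (n + 1)|⁻¹) {T L : ℝ} (hT : 0 < T) (hL : 2 ≤ L) :
    1 / (16 * Real.pi) * (muPlus a b).real {E : ℝ | scaleTilde a b T⁻¹ E ≤ L} <
      timeAvg T fun t => truncNormSq L (expNegI (halfLineOp a b) t delta1) := by
  have hε : 0 < T⁻¹ := inv_pos.2 hT
  have hA := isSymmetricOp_halfLineOp (b := b) hsum
  have honto := fun (w : ℂ) (hw : w.im ≠ 0) => isOntoAt_halfLineOp (b := b) hsum hw
  have hU := isUnitaryGroupOf_expNegI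
    (exists_isUnitaryGroupOf hA (honto _ (by simp)) (honto _ (by simp)))
  have hμ : IsSpectralMeasure (halfLineOp a b) delta1 (muPlus a b) :=
    isSpectralMeasure_spectralMeasure
      (exists_isSpectralMeasure hA (honto _ (by simp)) (honto _ (by simp)) _)
  have := hμ.finite
  set ε : ℝ := T⁻¹ with hεT
  have him : ∀ E : ℝ, ((E : ℂ) + ε * Complex.I).im = ε := fun E => by simp
  choose φ hφ using fun E : ℝ =>
    honto ((E : ℂ) + ε * Complex.I) (by rw [him]; exact hε.ne') delta1
  obtain ⟨hcont, hint, havg⟩ := timeAvg_truncNormSq hU hT hφ L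
  have hpos : ∀ E, 0 < truncNormSq L (φ E) := fun E => truncNormSq_pos ha0 (hφ E) hL
  have hM : Continuous fun E => (greenSeq (φ E) 1).im := by
    have h1 := (integral_norm_sq_resolvent hU hε hφ 1).1
    simp only [← inner_delta1, ← site_one, inner_site]
    exact Complex.continuous_im.comp h1
  have hMμ : ∀ E, (greenSeq (φ E) 1).im = ∫ x, ε / ((x - E) ^ 2 + ε ^ 2) ∂(muPlus a b) := by
    intro E
    have hz : ((E : ℂ) + ε * Complex.I).im ≠ 0 := by rw [him]; exact hε.ne'
    rw [← im_integral_inv_sub E hε, ← hμ.transform _ hz, borelTransform,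
      resolventApply_eq hA hz (hφ E), inner_delta1]
  have hS : ∀ x ∈ {E : ℝ | scaleTilde a b ε E ≤ L}, ∀ E, |E - x| ≤ ε →
      (greenSeq (φ E) 1).im ≤ (8 * ε) * truncNormSq L (φ E) := by
    intro x hx E hE
    obtain ⟨h1, h2⟩ := scaleTilde_spec (b := b) ha ha0 hsum x hε
    -- Real and imaginary parts of z - x are both at most ε in size.
    have h3 : ‖((E : ℂ) + ε * Complex.I) - x‖ ^ 2 ≤ 2 * ε ^ 2 := by
      rw [← Complex.normSq_eq_norm_sq, Complex.normSq_apply]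
      have h4 : (E - x) ^ 2 ≤ ε ^ 2 := by rw [← sq_abs]; exact pow_le_pow_left₀ (abs_nonneg _) hE 2
      simp
      nlinarith
    have h5 := im_greenSeq_one hA (hφ E)
    rw [him] at h5
    have h6 := im_le_truncSq ha ha0 hε (him E) h3 (isSolution_greenSeq ha0 (hφ E)) rfl
      (by rw [h5]; exact mul_le_mul_of_nonneg_left (two_terms_le (φ E)) hε.le) h1 h2
    have h7 := truncSq_mono (greenSeq (φ E)) (by linarith) hx
    simp only [truncSq_greenSeq] at h6 h7
    have h8 := mul_le_mul_of_nonneg_left h7 hε.le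
    linarith
  have hmain := measureReal_le_integral hε (by positivity) hcont (fun E => (hpos E).le) hint hM hMμ
    hS
  have hIpos : 0 < ∫ E, truncNormSq L (φ E) := by
    rw [integral_pos_iff_support_of_nonneg (fun E => (hpos E).le) hint]
    have : Function.support (fun E => truncNormSq L (φ E)) = Set.univ :=
      Set.eq_univ_of_forall fun E => (hpos E).ne'
    rw [this]
    simp
  rw [havg]
  have hπ := Real.pi_pos
  -- The estimate gives μ⁺(S) ≤ 8ε ∫ ‖φ_E‖_L² dE = 8π times the time average. Using 16π instead
  -- makes the inequality strict, since the time average is positive.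
  calc 1 / (16 * Real.pi) * (muPlus a b).real {E : ℝ | scaleTilde a b ε E ≤ L}
      ≤ 1 / (16 * Real.pi) * (8 * ε * ∫ E, truncNormSq L (φ E)) := by gcongr
    _ = 1 / 2 * (ε / Real.pi * ∫ E, truncNormSq L (φ E)) := by field_simp; ring
    _ < ε / Real.pi * ∫ E, truncNormSq L (φ E) := by
      have : 0 < ε / Real.pi * ∫ E, truncNormSq L (φ E) := by positivity
      linarith

end

end JacobiDyn

end

theorem corollary1p2 :
    ∃ C : ℝ, 0 < C ∧
      ∀ a b : ℕ → ℝ, (∀ n, a n ≠ 0) → a 0 = 1 → (¬ Summable fun n : ℕ => |a (n + 1)|⁻¹) →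
        ∀ T L : ℝ, 0 < T → 2 ≤ L →
          C * (JacobiDyn.muPlus a b).real {E : ℝ | JacobiDyn.scaleTilde a b T⁻¹ E ≤ L} <
            JacobiDyn.timeAvg T fun t =>
              JacobiDyn.truncNormSq L
                (JacobiDyn.expNegI (JacobiDyn.halfLineOp a b) t JacobiDyn.delta1) :=
  ⟨1 / (16 * Real.pi), by positivity, fun _ _ ha ha0 hsum _ _ hT hL =>
    JacobiDyn.muPlus_lt_timeAvg ha ha0 hsum hT hL⟩
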